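/- Let $\mathbb S^1=\mathbb R/\mathbb Z$, let $\Gamma$ be a subgroup of the group $\mathrm{Diff}^{\omega}_+(\mathbb S^1)$ of orientation-preserving real analytic diffeomorphisms of $\mathbb S^1$, and let $p\in\mathbb S^1$. Assume that the stabilizer $\mathrm{Stab}_p(\Gamma)=\{g\in\Gamma : g(p)=p\}$ is not a cyclic group (the trivial group counts as cyclic). Then: 1. $\Gamma$ is locally nondiscrete with respect to the $C^1$-topology: there exist a nonempty open interval $I\subset\mathbb S^1$ and a sequence of elements of $\Gamma\setminus\{\mathrm{id}\}$ that converges to the identity on $I$ in the $C^1$-topology (uniform convergence on $I$ of the maps and of their first derivatives). 2. There exists a nowhere vanishing continuous vector field $X$, defined on some nonempty open interval $J\subset\mathbb S^1$, which is in the $C^0$-closure of $\Gamma$ relative to $J$: for every compact subinterval $J_0\subset J$ and every $t_0>0$ such that the local flow $\varphi^t$ of $X$ in $J$ is defined on $J_0$ for all $0\le t\le t_0$, the map $\varphi^{t_0}$ is the uniform limit on $J_0$ of the restrictions to $J_0$ of a sequence of elements of $\Gamma$. -/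

import Mathlib

open Set Filter Topology

namespace CircleDiff

/-- `F : ℝ → ℝ` is a lift of the homeomorphism `f` of the circle `S¹ = ℝ/ℤ`: it is continuous and
covers `f` under the projection `ℝ → ℝ/ℤ`. -/
def IsLift (F : ℝ → ℝ) (f : UnitAddCircle ≃ₜ UnitAddCircle) : Prop :=
  Continuous F ∧ ∀ x : ℝ, (F x : UnitAddCircle) = f (x : UnitAddCircle)

/-- `f` has a real analytic lift with everywhere positive derivative, i.e. `f` is real analytic,
orientation preserving, and without critical points. -/
def HasAnalyticLift (f : UnitAddCircle ≃ₜ UnitAddCircle) : Prop :=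
  ∃ F : ℝ → ℝ, IsLift F f ∧ AnalyticOnNhd ℝ F univ ∧ ∀ x : ℝ, 0 < deriv F x

theorem hasAnalyticLift_one : HasAnalyticLift 1 := by
  refine ⟨id, ⟨continuous_id, fun x => rfl⟩, analyticOnNhd_id, fun x => ?_⟩
  simp

theorem HasAnalyticLift.mul {f g : UnitAddCircle ≃ₜ UnitAddCircle}
    (hf : HasAnalyticLift f) (hg : HasAnalyticLift g) : HasAnalyticLift (f * g) := by
  obtain ⟨F, ⟨hFc, hF⟩, hFa, hFd⟩ := hf
  obtain ⟨G, ⟨hGc, hG⟩, hGa, hGd⟩ := hg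
  refine ⟨F ∘ G, ⟨hFc.comp hGc, fun x => ?_⟩, fun x _ => ?_, fun x => ?_⟩
  · rw [Function.comp_apply, hF, hG]; rfl
  · exact (hFa (G x) (mem_univ _)).comp (hGa x (mem_univ _))
  · rw [deriv_comp x (hFa (G x) (mem_univ _)).differentiableAt
      (hGa x (mem_univ _)).differentiableAt]
    exact mul_pos (hFd _) (hGd _)

/-- The group `Diff^ω_+(S¹)` of orientation-preserving real analytic diffeomorphisms of the circle
`S¹ = ℝ/ℤ`, as a subgroup of the group of homeomorphisms: both the map and its inverse are real
analytic and orientation preserving. -/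
def DiffOmegaPlus : Subgroup (UnitAddCircle ≃ₜ UnitAddCircle) where
  carrier := {f | HasAnalyticLift f ∧ HasAnalyticLift f⁻¹}
  one_mem' := ⟨hasAnalyticLift_one, by rw [inv_one]; exact hasAnalyticLift_one⟩
  mul_mem' := fun {f g} hf hg => ⟨hf.1.mul hg.1, by rw [mul_inv_rev]; exact hg.2.mul hf.2⟩
  inv_mem' := fun {f} hf => ⟨hf.2, by rw [inv_inv]; exact hf.1⟩

/-- The stabilizer of the point `p` in the group `Γ`. -/
def stab (Γ : Subgroup (UnitAddCircle ≃ₜ UnitAddCircle)) (p : UnitAddCircle) : Subgroup Γ where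
  carrier := {g | g.1 p = p}
  one_mem' := rfl
  mul_mem' := fun {f g} (hf : f.1 p = p) (hg : g.1 p = p) => by
    change f.1 (g.1 p) = p
    rw [hg, hf]
  inv_mem' := fun {f} (hf : f.1 p = p) => by
    change f.1.symm p = p
    rw [Homeomorph.symm_apply_eq, hf]

/-- An interval of the circle is given by an interval `S ⊆ ℝ` (with more than one point) that
projects injectively to `ℝ/ℤ`, and a map from it to the circle is given by a lift `h : ℝ → ℝ`, of
which only the values on `S` matter. The sequence `g` converges to this map on this interval in the
`C^r`-topology (`0 ≤ r ≤ ∞`): for suitable lifts of the `g n`, all derivatives of order `k ≤ r`,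
including order `0`, converge uniformly on `S` to the corresponding derivatives of `h`. -/
def CrTendstoOn (r : ℕ∞) (g : ℕ → (UnitAddCircle ≃ₜ UnitAddCircle)) (h : ℝ → ℝ)
    (S : Set ℝ) : Prop :=
  ∃ G : ℕ → ℝ → ℝ, (∀ n, IsLift (G n) (g n)) ∧
    ∀ k : ℕ, (k : ℕ∞) ≤ r →
      TendstoUniformlyOn (fun n => iteratedDeriv k (G n)) (iteratedDerivWithin k h S) atTop S

/-- `Γ` is locally nondiscrete with respect to the `C^r`-topology: some sequence in `Γ \ {id}`
converges to the identity in the `C^r`-topology on an open interval of the circle, namely the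
injective image of `]a, b[` with `a < b ≤ a + 1`. -/
def LocallyNondiscrete (r : ℕ∞) (Γ : Subgroup (UnitAddCircle ≃ₜ UnitAddCircle)) : Prop :=
  ∃ a b : ℝ, a < b ∧ b ≤ a + 1 ∧
    ∃ g : ℕ → (UnitAddCircle ≃ₜ UnitAddCircle),
      (∀ n, g n ∈ Γ ∧ g n ≠ 1) ∧ CrTendstoOn r g id (Ioo a b)

/-- `φ` (as `φ t x`) is the local flow on the set `K` for times `0 ≤ t ≤ t₀` of the vector field
`X(x) ∂/∂x` defined on `J`: each curve `t ↦ φ t x` with `x ∈ K` starts at `x`, stays in `J`, and is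
an integral curve of `X`. -/
def IsLocalFlowOn (X : ℝ → ℝ) (J K : Set ℝ) (t₀ : ℝ) (φ : ℝ → ℝ → ℝ) : Prop :=
  ∀ x ∈ K, φ 0 x = x ∧ (∀ t ∈ Icc 0 t₀, φ t x ∈ J) ∧
    IsIntegralCurveOn (fun t => φ t x) (fun _ => X) (Icc 0 t₀)

/-- The vector field `X(x) ∂/∂x`, defined on the open interval of the circle that is the injective
image of `]a, b[`, is in the `C^r`-closure of `Γ` relative to this interval: whenever its local flow
`φ` is defined on a compact subinterval `[c, d]` for all `0 ≤ t ≤ t₀`, the map `φ^{t₀}` is on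
`[c, d]` the `C^r`-limit of a sequence of elements of `Γ`. -/
def InCrClosure (r : ℕ∞) (Γ : Subgroup (UnitAddCircle ≃ₜ UnitAddCircle)) (a b : ℝ)
    (X : ℝ → ℝ) : Prop :=
  ∀ c d : ℝ, c < d → Icc c d ⊆ Ioo a b → ∀ t₀ : ℝ, 0 < t₀ → ∀ φ : ℝ → ℝ → ℝ,
    IsLocalFlowOn X (Ioo a b) (Icc c d) t₀ φ →
      ∃ g : ℕ → (UnitAddCircle ≃ₜ UnitAddCircle),
        (∀ n, g n ∈ Γ) ∧ CrTendstoOn r g (φ t₀) (Icc c d)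

end CircleDiff

/-! ### Abel coordinate of a contraction -/

namespace CircleDiff

/-! Lifts fixing a point over `p` turn the stabilizer into a faithful group of analytic
diffeomorphisms of the line fixing `0`. By analyticity every nontrivial element is `x + b x ^ r +
o(x ^ r)` at `0⁺` with `b ≠ 0`. Take a contraction `f` of minimal order `q`. It has an Abel
coordinate `τ`, in which it is a translation, and the density `w = τ'` satisfies `w (f x) * f' x = w
x` and `w x ~ A / x ^ q`. Any other element of order `r ≥ q` then has Abel displacement `τ (g x) - τ
x ~ c * x ^ (r - q)` with `c ≠ 0`, and nearly preserves the density `w` close to `0`.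

Conjugation by `f ^ n` carries this behaviour near `0` to a fixed interval `[a, b]`: the conjugate
`f⁻ⁿ g fⁿ` has at `x` the Abel displacement that `g` has at `fⁿ x`. This gives group elements `k n ≠
1` with displacement `~ ε n * X` and derivative tending to `1` on `[a, b]`, where `ε n → 0` and `X >
0` is continuous (`IsApproximation`). Two cases arise. If some element has order `r > q`, its
conjugates work, because the ratios of points of two `f`-orbits converge (`tendsto_iterate_ratio`).
If all orders equal `q`, the limit of the Abel displacement is an injective homomorphism to `ℝ`; as
the group is not cyclic, its image is dense, and elements with small limit, conjugated far enough,
work (`exists_small_translation`).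

The `k n` themselves give `C¹` nondiscreteness. Iterating `k n` about `t₀ / ε n` times is Euler's
method for `X`, so it converges to the time-`t₀` flow (`tendstoUniformlyOn_iterate_flow`). -/

/-- `f` is a `C²` diffeomorphism near `[0, δ[` which fixes `0` and moves the points of `]0, δ[`
towards `0`; `log f'` is `C`-Lipschitz there. -/
structure IsContractionOn (f : ℝ → ℝ) (δ C : ℝ) : Prop where
  contDiff : ContDiff ℝ 2 f
  map_zero : f 0 = 0
  deriv_pos : ∀ x, 0 < deriv f x
  lt_self : ∀ x ∈ Ioo 0 δ, f x < x
  lipschitz : ∀ x ∈ Ioo 0 δ, ∀ y ∈ Ioo 0 δ,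
    |Real.log (deriv f x) - Real.log (deriv f y)| ≤ C * |x - y|

/-- The logarithm of `Δ (f x) / (Δ x * f' x)`, where `Δ x = x - f x`. -/
noncomputable def logRatio (f : ℝ → ℝ) (x : ℝ) : ℝ :=
  Real.log (f x - f (f x)) - Real.log (x - f x) - Real.log (deriv f x)

/-- The sum of `logRatio f` along the forward orbit of `x`. -/
noncomputable def logRatioSum (f : ℝ → ℝ) (x : ℝ) : ℝ := ∑' j, logRatio f (f^[j] x)

/-- The derivative of the Abel (or Fatou) coordinate of the contraction `f`. -/
noncomputable def abelDensity (f : ℝ → ℝ) (x : ℝ) : ℝ := Real.exp (-logRatioSum f x) / (x - f x)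

namespace IsContractionOn

variable {f : ℝ → ℝ} {δ C : ℝ}

theorem strictMono (h : IsContractionOn f δ C) : StrictMono f :=
  strictMono_of_deriv_pos h.deriv_pos

theorem differentiable (h : IsContractionOn f δ C) : Differentiable ℝ f :=
  h.contDiff.differentiable (by norm_num)

theorem continuous_deriv (h : IsContractionOn f δ C) : Continuous (deriv f) :=
  h.contDiff.continuous_deriv (by norm_num)

theorem mapsTo (h : IsContractionOn f δ C) {x : ℝ} (hx : x ∈ Ioo 0 δ) : f x ∈ Ioo 0 δ := by
  refine ⟨?_, (h.lt_self x hx).trans hx.2⟩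
  have := h.strictMono hx.1
  rwa [h.map_zero] at this

theorem iterate_mem (h : IsContractionOn f δ C) {x : ℝ} (hx : x ∈ Ioo 0 δ) (n : ℕ) :
    f^[n] x ∈ Ioo 0 δ := by
  induction n with
  | zero => simpa using hx
  | succ n ih => rw [Function.iterate_succ_apply']; exact h.mapsTo ih

theorem tendsto_iterate (h : IsContractionOn f δ C) {x : ℝ} (hx : x ∈ Ioo 0 δ) :
    Tendsto (fun n => f^[n] x) atTop (𝓝 0) := by
  have hanti : Antitone (fun n => f^[n] x) := antitone_nat_of_succ_le fun n => by
    rw [Function.iterate_succ_apply']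
    exact (h.lt_self _ (h.iterate_mem hx n)).le
  have hbdd : BddBelow (range fun n => f^[n] x) := ⟨0, by
    rintro _ ⟨n, rfl⟩; exact (h.iterate_mem hx n).1.le⟩
  have hlim := tendsto_atTop_ciInf hanti hbdd
  set l := ⨅ n, f^[n] x
  have hfix : f l = l := isFixedPt_of_tendsto_iterate hlim h.contDiff.continuous.continuousAt
  have hl0 : 0 ≤ l := le_ciInf fun n => (h.iterate_mem hx n).1.le
  have hlx : l ≤ x := ciInf_le hbdd 0
  rcases hl0.eq_or_lt with h0 | h0
  · rwa [← h0] at hlim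
  · exact absurd hfix (h.lt_self l ⟨h0, hlx.trans_lt hx.2⟩).ne

/-- By the mean value theorem the ratio of consecutive gaps is `f' ξ` with `ξ` between `f x` and
`x`, so `logRatio f x` is a difference of two values of `log f'`. The bound telescopes along orbits.
-/
theorem abs_logRatio_le (h : IsContractionOn f δ C) {x : ℝ} (hx : x ∈ Ioo 0 δ) (hC : 0 ≤ C) :
    |logRatio f x| ≤ C * (x - f x) := by
  have hlt := h.lt_self x hx
  obtain ⟨ξ, hξ, hslope⟩ := exists_deriv_eq_slope f hlt h.contDiff.continuous.continuousOn
    h.differentiable.differentiableOn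
  have hd : f x - f (f x) = deriv f ξ * (x - f x) := by
    rw [hslope, div_mul_cancel₀ _ (sub_pos.2 hlt).ne']
  have hξ' : ξ ∈ Ioo 0 δ := ⟨(h.mapsTo hx).1.trans hξ.1, hξ.2.trans hx.2⟩
  have : logRatio f x = Real.log (deriv f ξ) - Real.log (deriv f x) := by
    rw [logRatio, hd, Real.log_mul (h.deriv_pos ξ).ne' (sub_pos.2 hlt).ne']
    ring
  rw [this]
  refine (h.lipschitz ξ hξ' x hx).trans (mul_le_mul_of_nonneg_left ?_ hC)
  rw [abs_sub_comm, abs_of_pos (sub_pos.2 hξ.2)]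
  linarith [hξ.1]

theorem sum_range_abs_logRatio_le (h : IsContractionOn f δ C) {x : ℝ} (hx : x ∈ Ioo 0 δ)
    (hC : 0 ≤ C) (n : ℕ) : ∑ j ∈ Finset.range n, |logRatio f (f^[j] x)| ≤ C * x := by
  calc ∑ j ∈ Finset.range n, |logRatio f (f^[j] x)|
      ≤ ∑ j ∈ Finset.range n, C * (f^[j] x - f^[j + 1] x) := by
        refine Finset.sum_le_sum fun j _ => ?_
        rw [Function.iterate_succ_apply']
        exact h.abs_logRatio_le (h.iterate_mem hx j) hC
    _ = C * (x - f^[n] x) := by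
        rw [← Finset.mul_sum, Finset.sum_range_sub']
        rfl
    _ ≤ C * x := mul_le_mul_of_nonneg_left (by linarith [(h.iterate_mem hx n).1]) hC

theorem summable_abs_logRatio (h : IsContractionOn f δ C) {x : ℝ} (hx : x ∈ Ioo 0 δ)
    (hC : 0 ≤ C) : Summable fun j => |logRatio f (f^[j] x)| :=
  summable_of_sum_range_le (fun _ => abs_nonneg _) (h.sum_range_abs_logRatio_le hx hC)

theorem abs_logRatioSum_le (h : IsContractionOn f δ C) {x : ℝ} (hx : x ∈ Ioo 0 δ)
    (hC : 0 ≤ C) : |logRatioSum f x| ≤ C * x :=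
  (norm_tsum_le_tsum_norm (f := fun j => logRatio f (f^[j] x))
    (h.summable_abs_logRatio hx hC)).trans
    (Real.tsum_le_of_sum_range_le (fun _ => abs_nonneg _) (h.sum_range_abs_logRatio_le hx hC))

theorem sum_range_add_logRatioSum (h : IsContractionOn f δ C) {x : ℝ} (hx : x ∈ Ioo 0 δ)
    (hC : 0 ≤ C) (n : ℕ) :
    ∑ j ∈ Finset.range n, logRatio f (f^[j] x) + logRatioSum f (f^[n] x) = logRatioSum f x := by
  rw [logRatioSum, logRatioSum, ← (h.summable_abs_logRatio hx hC).of_abs.sum_add_tsum_nat_add n]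
  simp only [Function.iterate_add_apply]

theorem continuousOn_logRatio (h : IsContractionOn f δ C) :
    ContinuousOn (logRatio f) (Ioo 0 δ) := by
  have hc := h.contDiff.continuous
  have hdc := h.continuous_deriv
  refine ContinuousOn.sub (ContinuousOn.sub ?_ ?_) ?_
  · refine ContinuousOn.log (by fun_prop) fun x hx => (sub_pos.2 ?_).ne'
    exact h.lt_self _ (h.mapsTo hx)
  · exact ContinuousOn.log (by fun_prop) fun x hx => (sub_pos.2 (h.lt_self _ hx)).ne'
  · exact ContinuousOn.log hdc.continuousOn fun x _ => (h.deriv_pos x).ne'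

theorem continuousOn_logRatioSum (h : IsContractionOn f δ C) (hC : 0 ≤ C) :
    ContinuousOn (logRatioSum f) (Ioo 0 δ) := by
  intro x hx
  obtain ⟨b, hxb, hbδ⟩ := exists_between hx.2
  have hb : b ∈ Ioo 0 δ := ⟨hx.1.trans hxb, hbδ⟩
  -- The tail after `n` terms is `logRatioSum` at the `n`-th iterate, at most `C * f^[n] b` for all
  -- points below `b`.
  have hunif : TendstoUniformlyOn
      (fun n y => ∑ j ∈ Finset.range n, logRatio f (f^[j] y)) (logRatioSum f) atTop
      (Ioo 0 b) := by
    rw [Metric.tendstoUniformlyOn_iff]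
    intro ε hε
    have hlim : Tendsto (fun n => C * f^[n] b) atTop (𝓝 0) := by
      simpa using (h.tendsto_iterate hb).const_mul C
    filter_upwards [hlim.eventually_lt_const hε] with n hn y hy
    have hy' : y ∈ Ioo 0 δ := ⟨hy.1, hy.2.trans hbδ⟩
    rw [← h.sum_range_add_logRatioSum hy' hC n, Real.dist_eq, add_sub_cancel_left]
    refine lt_of_le_of_lt ((h.abs_logRatioSum_le (h.iterate_mem hy' n) hC).trans
      (mul_le_mul_of_nonneg_left ?_ hC)) hn
    exact (h.strictMono.iterate n).monotone hy.2.le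
  have hcont : ContinuousOn (logRatioSum f) (Ioo 0 b) := by
    refine hunif.continuousOn (Frequently.of_forall fun n => ?_)
    refine continuousOn_finsetSum _ fun j _ => ?_
    refine h.continuousOn_logRatio.comp (h.contDiff.continuous.iterate j).continuousOn ?_
    exact fun y hy => h.iterate_mem ⟨hy.1, hy.2.trans hbδ⟩ j
  exact (hcont.continuousAt (Ioo_mem_nhds hx.1 hxb)).continuousWithinAt

theorem abelDensity_pos (h : IsContractionOn f δ C) {x : ℝ} (hx : x ∈ Ioo 0 δ) :
    0 < abelDensity f x :=
  div_pos (Real.exp_pos _) (sub_pos.2 (h.lt_self x hx))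

theorem continuousOn_abelDensity (h : IsContractionOn f δ C) (hC : 0 ≤ C) :
    ContinuousOn (abelDensity f) (Ioo 0 δ) :=
  (h.continuousOn_logRatioSum hC).neg.rexp.div
    (continuous_id.sub h.contDiff.continuous).continuousOn
    fun x hx => (sub_pos.2 (h.lt_self x hx)).ne'

/-- `1 / (x - f x)` is invariant only up to the factor `exp (logRatio f x)`; summing these defects
along the orbit corrects it, since shifting the orbit drops exactly the first term. -/
theorem abelDensity_map_mul_deriv (h : IsContractionOn f δ C) (hC : 0 ≤ C) {x : ℝ}
    (hx : x ∈ Ioo 0 δ) : abelDensity f (f x) * deriv f x = abelDensity f x := by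
  have h1 := h.sum_range_add_logRatioSum hx hC 1
  simp only [Finset.range_one, Finset.sum_singleton, Function.iterate_zero, id,
    Function.iterate_one] at h1
  have hp1 := sub_pos.2 (h.lt_self x hx)
  have hp2 := sub_pos.2 (h.lt_self _ (h.mapsTo hx))
  have hp3 := h.deriv_pos x
  have h2 : -logRatioSum f (f x) = -logRatioSum f x + logRatio f x := by rw [← h1]; ring
  rw [abelDensity, abelDensity, h2, Real.exp_add, logRatio, Real.exp_sub, Real.exp_sub,
    Real.exp_log hp1, Real.exp_log hp2, Real.exp_log hp3]
  field_simp

theorem tendsto_abelDensity_mul_sub (h : IsContractionOn f δ C) (hδ : 0 < δ) (hC : 0 ≤ C) :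
    Tendsto (fun x => abelDensity f x * (x - f x)) (𝓝[>] 0) (𝓝 1) := by
  have hL : Tendsto (logRatioSum f) (𝓝[>] 0) (𝓝 0) := by
    have hlim : Tendsto (fun x : ℝ => C * x) (𝓝[>] 0) (𝓝 0) := by
      have : Tendsto (fun x : ℝ => C * x) (𝓝 0) (𝓝 (C * 0)) := (continuous_const_mul C).tendsto 0
      rw [mul_zero] at this
      exact this.mono_left nhdsWithin_le_nhds
    refine squeeze_zero_norm' ?_ hlim
    filter_upwards [Ioo_mem_nhdsGT hδ] with x hx using h.abs_logRatioSum_le hx hC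
  have hE : Tendsto (fun x => Real.exp (-logRatioSum f x)) (𝓝[>] 0) (𝓝 1) := by
    have := (Real.continuous_exp.tendsto _).comp hL.neg
    simpa [Function.comp_def] using this
  refine hE.congr' ?_
  filter_upwards [Ioo_mem_nhdsGT hδ] with x hx
  rw [abelDensity, div_mul_cancel₀ _ (sub_pos.2 (h.lt_self x hx)).ne']

end IsContractionOn

theorem exists_hasDerivAt_of_continuousOn_Ioo {w : ℝ → ℝ} {a b : ℝ} (hab : a < b)
    (hw : ContinuousOn w (Ioo a b)) : ∃ τ : ℝ → ℝ, ∀ x ∈ Ioo a b, HasDerivAt τ (w x) x := by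
  obtain ⟨c, hc⟩ := nonempty_Ioo.2 hab
  refine ⟨fun x => ∫ t in c..x, w t, fun x hx => ?_⟩
  have hsub : uIcc c x ⊆ Ioo a b := ordConnected_Ioo.uIcc_subset hc hx
  exact intervalIntegral.integral_hasDerivAt_right (hw.mono hsub).intervalIntegrable
    (hw.stronglyMeasurableAtFilter isOpen_Ioo x hx) (hw.continuousAt (isOpen_Ioo.mem_nhds hx))

/-- An Abel coordinate `τ` with derivative `w` of the contraction `f` on `]0, δ[`. -/
structure IsAbelCoordinate (f w τ : ℝ → ℝ) (δ κ : ℝ) : Prop where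
  pos : ∀ x ∈ Ioo 0 δ, 0 < w x
  continuousOn : ContinuousOn w (Ioo 0 δ)
  hasDerivAt : ∀ x ∈ Ioo 0 δ, HasDerivAt τ (w x) x
  map : ∀ x ∈ Ioo 0 δ, τ (f x) = τ x - κ
  density_map : ∀ x ∈ Ioo 0 δ, w (f x) * deriv f x = w x

/-- Invariance of the density says that `τ ∘ f - τ` has zero derivative on `]0, δ[`. -/
theorem IsContractionOn.exists_abelCoordinate {f : ℝ → ℝ} {δ C : ℝ} (h : IsContractionOn f δ C)
    (hδ : 0 < δ) (hC : 0 ≤ C) :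
    ∃ τ κ, IsAbelCoordinate f (abelDensity f) τ δ κ := by
  obtain ⟨τ, hτ⟩ := exists_hasDerivAt_of_continuousOn_Ioo hδ (h.continuousOn_abelDensity hC)
  have hder : ∀ x ∈ Ioo 0 δ, HasDerivAt (fun x => τ (f x) - τ x) 0 x := fun x hx => by
    have := ((hτ _ (h.mapsTo hx)).comp x (h.differentiable x).hasDerivAt).sub (hτ x hx)
    rwa [h.abelDensity_map_mul_deriv hC hx, sub_self] at this
  refine ⟨τ, -(τ (f (δ / 2)) - τ (δ / 2)), fun x => h.abelDensity_pos,
    h.continuousOn_abelDensity hC, hτ, fun x hx => ?_,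
    fun x => h.abelDensity_map_mul_deriv hC⟩
  have := isOpen_Ioo.is_const_of_deriv_eq_zero isPreconnected_Ioo
    (fun x hx => (hder x hx).differentiableAt.differentiableWithinAt)
    (fun x hx => (hder x hx).deriv) hx (show δ / 2 ∈ Ioo 0 δ from ⟨by linarith, by linarith⟩)
  linarith

theorem exists_isContractionOn {f : ℝ → ℝ} (hf : ContDiff ℝ 2 f) (h0 : f 0 = 0)
    (hd : ∀ x, 0 < deriv f x) (hlt : ∀ᶠ x in 𝓝[>] 0, f x < x) :
    ∃ δ C, 0 < δ ∧ 0 ≤ C ∧ IsContractionOn f δ C := by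
  have hlog : ContDiffAt ℝ 1 (fun x => Real.log (deriv f x)) 0 := by
    refine ContDiffAt.log ?_ (hd 0).ne'
    exact ((contDiff_succ_iff_deriv (n := 1)).1 hf).2.2.contDiffAt
  obtain ⟨K, t, ht, hK⟩ := hlog.exists_lipschitzOnWith
  have hmem : t ∩ {x | f x < x} ∈ 𝓝[>] (0 : ℝ) :=
    inter_mem (mem_nhdsWithin_of_mem_nhds ht) hlt
  obtain ⟨δ, hδ, hsub⟩ := (mem_nhdsGT_iff_exists_Ioo_subset).1 hmem
  refine ⟨δ, K, hδ, K.2, hf, h0, hd, fun x hx => (hsub hx).2, fun x hx y hy => ?_⟩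
  simpa [Real.dist_eq] using hK.dist_le_mul x (hsub hx).1 y (hsub hy).1

end CircleDiff

/-! ### Leading terms at the fixed point and displacements in the Abel coordinate -/

namespace CircleDiff

theorem exists_mem_uIcc_sub_eq {F F' : ℝ → ℝ} {y z : ℝ}
    (h : ∀ x ∈ uIcc y z, HasDerivAt F (F' x) x) :
    ∃ ξ ∈ uIcc y z, F z - F y = F' ξ * (z - y) := by
  rcases lt_trichotomy y z with hyz | rfl | hyz
  · rw [uIcc_of_le hyz.le] at h ⊢
    obtain ⟨ξ, hξ, hs⟩ := exists_hasDerivAt_eq_slope F F' hyz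
      (fun x hx => (h x hx).continuousAt.continuousWithinAt)
      (fun x hx => h x (Ioo_subset_Icc_self hx))
    exact ⟨ξ, Ioo_subset_Icc_self hξ, by rw [hs, div_mul_cancel₀ _ (sub_pos.2 hyz).ne']⟩
  · exact ⟨y, left_mem_uIcc, by simp⟩
  · rw [uIcc_of_ge hyz.le] at h ⊢
    obtain ⟨ξ, hξ, hs⟩ := exists_hasDerivAt_eq_slope F F' hyz
      (fun x hx => (h x hx).continuousAt.continuousWithinAt)
      (fun x hx => h x (Ioo_subset_Icc_self hx))
    refine ⟨ξ, Ioo_subset_Icc_self hξ, ?_⟩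
    rw [hs, ← neg_sub y z, mul_neg, div_mul_cancel₀ _ (sub_pos.2 hyz).ne', neg_sub]

section Between

variable {α : Type*} {l : Filter α} {u v ξ : α → ℝ}

theorem tendsto_of_mem_uIcc {c : ℝ} (hu : Tendsto u l (𝓝 c)) (hv : Tendsto v l (𝓝 c))
    (hξ : ∀ᶠ i in l, ξ i ∈ uIcc (u i) (v i)) : Tendsto ξ l (𝓝 c) := by
  refine tendsto_of_tendsto_of_tendsto_of_le_of_le' (g := fun i => min (u i) (v i))
    (h := fun i => max (u i) (v i)) (by simpa using hu.min hv) (by simpa using hu.max hv) ?_ ?_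
  · exact hξ.mono fun i hi => hi.1
  · exact hξ.mono fun i hi => hi.2

theorem tendsto_nhdsGT_of_mem_uIcc (hu : Tendsto u l (𝓝[>] 0)) (hv : Tendsto v l (𝓝[>] 0))
    (hξ : ∀ᶠ i in l, ξ i ∈ uIcc (u i) (v i)) : Tendsto ξ l (𝓝[>] 0) := by
  rw [tendsto_nhdsWithin_iff] at hu hv ⊢
  refine ⟨tendsto_of_mem_uIcc hu.1 hv.1 hξ, ?_⟩
  filter_upwards [hu.2, hv.2, hξ] with i h1 h2 h3
  exact (lt_min h1 h2).trans_le h3.1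

theorem tendsto_div_of_mem_uIcc (hu : ∀ᶠ i in l, 0 < u i)
    (h : Tendsto (fun i => v i / u i) l (𝓝 1))
    (hξ : ∀ᶠ i in l, ξ i ∈ uIcc (u i) (v i)) : Tendsto (fun i => ξ i / u i) l (𝓝 1) := by
  refine tendsto_of_mem_uIcc (u := fun _ => 1) tendsto_const_nhds h ?_
  filter_upwards [hu, hξ] with i h1 h2
  rw [mem_uIcc] at h2 ⊢
  rw [le_div_iff₀ h1, div_le_div_iff_of_pos_right h1, div_le_one h1, le_div_iff₀ h1,
    div_mul_cancel₀ _ h1.ne', one_mul]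
  exact h2

end Between

/-- `g x = x + b x ^ r + o(x ^ r)` as `x → 0⁺`. -/
def HasLeadingTerm (g : ℝ → ℝ) (r : ℕ) (b : ℝ) : Prop :=
  Tendsto (fun x => (g x - x) / x ^ r) (𝓝[>] 0) (𝓝 b)

/-- Factor the nonzero analytic germ `g x - x` as `x ^ r * k x` with `k 0 ≠ 0`; the fixed point
forces `r ≥ 1`. -/
theorem exists_hasLeadingTerm {g : ℝ → ℝ} (hg : AnalyticAt ℝ g 0) (h0 : g 0 = 0)
    (hne : ¬ ∀ᶠ x in 𝓝 0, g x = x) : ∃ r b, 1 ≤ r ∧ b ≠ 0 ∧ HasLeadingTerm g r b := by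
  have hga : AnalyticAt ℝ (fun x => g x - x) 0 := hg.sub analyticAt_id
  have hne' : ¬ ∀ᶠ x in 𝓝 0, g x - x = 0 := by simpa only [sub_eq_zero] using hne
  obtain ⟨r, k, hk, hk0, hgk⟩ := hga.exists_eventuallyEq_pow_smul_nonzero_iff.2 hne'
  refine ⟨r, k 0, ?_, hk0, ?_⟩
  · rcases Nat.eq_zero_or_pos r with rfl | h
    · have := hgk.self_of_nhds
      simp [h0] at this
      exact absurd this.symm hk0
    · exact h
  · refine (hk.continuousAt.tendsto.mono_left nhdsWithin_le_nhds).congr' ?_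
    filter_upwards [nhdsWithin_le_nhds hgk, self_mem_nhdsWithin] with x hx hx0
    rw [hx, sub_zero, smul_eq_mul, mul_div_cancel_left₀ _ (pow_pos hx0 r).ne']

section GermLimits

variable {g g' : ℝ → ℝ} {r : ℕ} {b μ : ℝ}

theorem tendsto_nhdsGT_zero_of_strictMono (hg : Continuous g) (hm : StrictMono g) (h0 : g 0 = 0) :
    Tendsto g (𝓝[>] 0) (𝓝[>] 0) := by
  refine tendsto_nhdsWithin_iff.2 ⟨?_, ?_⟩
  · have := hg.tendsto 0
    rw [h0] at this
    exact this.mono_left nhdsWithin_le_nhds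
  · filter_upwards [self_mem_nhdsWithin] with x hx
    have := hm hx
    rwa [h0] at this

theorem tendsto_div_self_of_hasDerivAt (h0 : g 0 = 0) (hg : HasDerivAt g μ 0) :
    Tendsto (fun x => g x / x) (𝓝[>] 0) (𝓝 μ) := by
  have := (hasDerivAt_iff_tendsto_slope.1 hg).mono_left
    (nhdsWithin_mono (0 : ℝ) fun x (hx : 0 < x) => hx.ne')
  refine this.congr fun x => ?_
  rw [slope_def_field, h0, sub_zero, sub_zero]

theorem HasLeadingTerm.inv (h : HasLeadingTerm g r b) (hinv : ∀ x, g (g' x) = x)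
    (hg' : Tendsto g' (𝓝[>] 0) (𝓝[>] 0)) (hμ : Tendsto (fun x => g' x / x) (𝓝[>] 0) (𝓝 μ)) :
    HasLeadingTerm g' r (-(b * μ ^ r)) := by
  refine (((h.comp hg').mul (hμ.pow r)).neg).congr' ?_
  filter_upwards [self_mem_nhdsWithin, (tendsto_nhdsWithin_iff.1 hg').2] with x hx hgx
  have hx : 0 < x := hx
  have hgx : 0 < g' x := hgx
  simp only [Function.comp_apply, hinv, div_pow]
  field_simp
  ring

theorem HasLeadingTerm.tendsto_div (h : HasLeadingTerm g r b) (hr : 2 ≤ r) :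
    Tendsto (fun x => g x / x) (𝓝[>] 0) (𝓝 1) := by
  have h1 : Tendsto (fun x : ℝ => x ^ (r - 1)) (𝓝[>] 0) (𝓝 0) := by
    have : Tendsto (fun x : ℝ => x ^ (r - 1)) (𝓝 0) (𝓝 (0 ^ (r - 1))) :=
      (continuous_pow (r - 1)).tendsto 0
    rw [zero_pow (by omega)] at this
    exact this.mono_left nhdsWithin_le_nhds
  have h2 := (h.mul h1).const_add 1
  rw [mul_zero, add_zero] at h2
  refine h2.congr' ?_
  filter_upwards [self_mem_nhdsWithin] with x hx
  have hx : 0 < x := hx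
  obtain ⟨s, rfl⟩ : ∃ s, r = s + 1 := ⟨r - 1, by omega⟩
  simp only [Nat.add_sub_cancel]
  field_simp
  ring

theorem HasLeadingTerm.tendsto_div_one (h : HasLeadingTerm g 1 b) :
    Tendsto (fun x => g x / x) (𝓝[>] 0) (𝓝 (1 + b)) := by
  refine (h.const_add 1).congr' ?_
  filter_upwards [self_mem_nhdsWithin] with x hx
  have hx : 0 < x := hx
  field_simp
  ring

end GermLimits

namespace IsAbelCoordinate

variable {f w τ : ℝ → ℝ} {δ κ : ℝ}

theorem exists_sub_eq (h : IsAbelCoordinate f w τ δ κ) {y z : ℝ} (hy : y ∈ Ioo 0 δ)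
    (hz : z ∈ Ioo 0 δ) : ∃ ξ ∈ uIcc y z, τ z - τ y = w ξ * (z - y) :=
  exists_mem_uIcc_sub_eq fun x hx => h.hasDerivAt x (ordConnected_Ioo.uIcc_subset hy hz hx)

/-- The mean value theorem in the variable `log x`. It is needed when the ratio `z / y` does not
tend to `1`, as for hyperbolic germs. -/
theorem exists_sub_eq_log (h : IsAbelCoordinate f w τ δ κ) {y z : ℝ} (hy : y ∈ Ioo 0 δ)
    (hz : z ∈ Ioo 0 δ) :
    ∃ ξ ∈ uIcc y z, τ z - τ y = w ξ * ξ * (Real.log z - Real.log y) := by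
  have key : ∀ s ∈ uIcc (Real.log y) (Real.log z), Real.exp s ∈ uIcc y z := fun s hs => by
    rw [mem_uIcc] at hs ⊢
    rwa [Real.log_le_iff_le_exp hy.1, Real.le_log_iff_exp_le hz.1,
      Real.log_le_iff_le_exp hz.1, Real.le_log_iff_exp_le hy.1] at hs
  obtain ⟨s, hs, heq⟩ := exists_mem_uIcc_sub_eq (F := fun s => τ (Real.exp s))
    (F' := fun s => w (Real.exp s) * Real.exp s) (y := Real.log y) (z := Real.log z)
    fun s hs => (h.hasDerivAt _ (ordConnected_Ioo.uIcc_subset hy hz (key s hs))).comp s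
      (Real.hasDerivAt_exp s)
  refine ⟨Real.exp s, key s hs, ?_⟩
  simpa only [Real.exp_log hy.1, Real.exp_log hz.1] using heq

theorem strictMonoOn (h : IsAbelCoordinate f w τ δ κ) : StrictMonoOn τ (Ioo 0 δ) := by
  refine strictMonoOn_of_deriv_pos (convex_Ioo 0 δ)
    (fun x hx => (h.hasDerivAt x hx).continuousAt.continuousWithinAt) fun x hx => ?_
  rw [interior_Ioo] at hx
  rw [(h.hasDerivAt x hx).deriv]
  exact h.pos x hx

variable {g : ℝ → ℝ} {q r : ℕ} {A b : ℝ}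

/-- The displacement of `g` in the Abel coordinate is equivalent to a monomial at `0`. -/
theorem exists_tendsto_displacement (h : IsAbelCoordinate f w τ δ κ) (hδ : 0 < δ) (hA : 0 < A)
    (hw : Tendsto (fun x => w x * x ^ q) (𝓝[>] 0) (𝓝 A)) (hq : 1 ≤ q) (hqr : q ≤ r)
    (hg : Tendsto g (𝓝[>] 0) (𝓝[>] 0)) (hgr : HasLeadingTerm g r b) (hb : b ≠ 0)
    (hb1 : r = 1 → 0 < 1 + b) :
    ∃ c, 0 < c * b ∧ Tendsto (fun x => (τ (g x) - τ x) / x ^ (r - q)) (𝓝[>] 0) (𝓝 c) := by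
  have hmem : ∀ᶠ x in 𝓝[>] 0, x ∈ Ioo 0 δ := Ioo_mem_nhdsGT hδ
  have hgmem : ∀ᶠ x in 𝓝[>] 0, g x ∈ Ioo 0 δ := hg.eventually hmem
  -- For `r = 1` also `q = 1`, and `g x / x` tends to `1 + b ≠ 1`, so the logarithmic mean value
  -- theorem is used and `c = A * log (1 + b)`. For `r ≥ 2` intermediate points satisfy `ξ / x → 1`,
  -- and `c = A * b`.
  rcases (hq.trans hqr).eq_or_lt with rfl | hr
  · obtain rfl : q = 1 := le_antisymm hqr hq
    have hlog : Tendsto (fun x => Real.log (g x / x)) (𝓝[>] 0) (𝓝 (Real.log (1 + b))) :=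
      hgr.tendsto_div_one.log (hb1 rfl).ne'
    have hex : ∀ᶠ x in 𝓝[>] 0, ∃ ξ, ξ ∈ uIcc x (g x) ∧
        τ (g x) - τ x = w ξ * ξ * (Real.log (g x) - Real.log x) := by
      filter_upwards [hmem, hgmem] with x hx hgx
      exact h.exists_sub_eq_log hx hgx
    obtain ⟨ξ, hξ⟩ := hex.choice
    have hξ0 : Tendsto ξ (𝓝[>] 0) (𝓝[>] 0) :=
      tendsto_nhdsGT_of_mem_uIcc tendsto_id hg (hξ.mono fun x hx => hx.1)
    refine ⟨A * Real.log (1 + b), ?_, ?_⟩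
    · have : 0 < Real.log (1 + b) * b := by
        rcases hb.lt_or_gt with hb' | hb'
        · exact mul_pos_of_neg_of_neg (Real.log_neg (hb1 rfl) (by linarith)) hb'
        · exact mul_pos (Real.log_pos (by linarith)) hb'
      rw [mul_assoc]
      exact mul_pos hA this
    · refine ((hw.comp hξ0).mul hlog).congr' ?_
      filter_upwards [hξ, hmem, hgmem] with x hx hx0 hgx
      rw [hx.2, Real.log_div hgx.1.ne' hx0.1.ne']
      simp
  · have hex : ∀ᶠ x in 𝓝[>] 0, ∃ ξ, ξ ∈ uIcc x (g x) ∧ τ (g x) - τ x = w ξ * (g x - x) := by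
      filter_upwards [hmem, hgmem] with x hx hgx
      exact h.exists_sub_eq hx hgx
    obtain ⟨ξ, hξ⟩ := hex.choice
    have hξ0 : Tendsto ξ (𝓝[>] 0) (𝓝[>] 0) :=
      tendsto_nhdsGT_of_mem_uIcc tendsto_id hg (hξ.mono fun x hx => hx.1)
    have hξ1 : Tendsto (fun x => ξ x / x) (𝓝[>] 0) (𝓝 1) :=
      tendsto_div_of_mem_uIcc (u := fun x => x) (v := g) (hmem.mono fun x hx => hx.1)
        (hgr.tendsto_div hr) (hξ.mono fun x hx => hx.1)
    refine ⟨A * b, by rw [mul_assoc]; exact mul_pos hA (mul_self_pos.2 hb), ?_⟩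
    have hlim := (((hw.comp hξ0).mul ((hξ1.inv₀ one_ne_zero).pow q)).mul hgr)
    rw [inv_one, one_pow, mul_one] at hlim
    refine hlim.congr' ?_
    filter_upwards [hξ, hmem, (tendsto_nhdsWithin_iff.1 hξ0).2] with x hx hx0 hξx
    have hξx : 0 < ξ x := hξx
    have hx0 := hx0.1
    obtain ⟨s, rfl⟩ : ∃ s, r = q + s := ⟨r - q, by omega⟩
    rw [hx.2, Nat.add_sub_cancel_left, pow_add, Function.comp_apply, inv_div, div_pow]
    field_simp

/-- The Abel density is asymptotically invariant under germs of sufficiently high order. -/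
theorem tendsto_deriv_mul_density (hA : 0 < A)
    (hw : Tendsto (fun x => w x * x ^ q) (𝓝[>] 0) (𝓝 A))
    (hg : Tendsto g (𝓝[>] 0) (𝓝[>] 0)) {μ : ℝ} (hμ0 : 0 < μ) (hμq : μ ^ q = μ)
    (hμ : Tendsto (fun x => g x / x) (𝓝[>] 0) (𝓝 μ))
    (hμ' : Tendsto (deriv g) (𝓝[>] 0) (𝓝 μ)) :
    Tendsto (fun x => deriv g x * w (g x) / w x) (𝓝[>] 0) (𝓝 1) := by
  -- The limit is `μ * 1 * μ⁻¹ ^ q`, which is `1` because `μ ^ q = μ`.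
  have hlim := (hμ'.mul ((hw.comp hg).div hw hA.ne')).mul ((hμ.inv₀ hμ0.ne').pow q)
  rw [div_self hA.ne', mul_one, inv_pow, hμq, mul_inv_cancel₀ hμ0.ne'] at hlim
  refine hlim.congr' ?_
  filter_upwards [self_mem_nhdsWithin, (tendsto_nhdsWithin_iff.1 hg).2] with x hx hgx
  have hx : 0 < x := hx
  have hgx : 0 < g x := hgx
  simp only [Function.comp_apply, Pi.div_apply, inv_div, div_pow]
  field_simp

theorem exists_tendsto_inv_mul_density (hA : 0 < A)
    (hw : Tendsto (fun x => w x * x ^ q) (𝓝[>] 0) (𝓝 A)) (hq : 1 ≤ q) :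
    ∃ β, Tendsto (fun x => (w x * x)⁻¹) (𝓝[>] 0) (𝓝 β) := by
  have h1 : Tendsto (fun x : ℝ => x ^ (q - 1)) (𝓝[>] 0) (𝓝 (0 ^ (q - 1))) :=
    ((continuous_pow (q - 1)).tendsto 0).mono_left nhdsWithin_le_nhds
  -- The limit is `0 ^ (q - 1) * A⁻¹`: it is `A⁻¹` for `q = 1` and `0` for `q ≥ 2`.
  refine ⟨_, (h1.mul (hw.inv₀ hA.ne')).congr' ?_⟩
  filter_upwards [self_mem_nhdsWithin] with x hx
  have hx : 0 < x := hx
  obtain ⟨s, rfl⟩ : ∃ s, q = s + 1 := ⟨q - 1, by omega⟩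
  rw [Nat.add_sub_cancel, pow_succ, mul_inv, mul_inv, mul_inv]
  field_simp

end IsAbelCoordinate

end CircleDiff

/-! ### Conjugation by iterates of the contraction, uniformly on compact intervals -/

namespace CircleDiff

section UniformFilter

variable {a b : ℝ}

/-- Uniform statements on `S` are phrased below as limits along `atTop ×ˢ 𝓟 S`, so that the usual
calculus of limits applies to them. -/
theorem eventually_atTop_prod_principal {P : ℕ → ℝ → Prop} {S : Set ℝ} :
    (∀ᶠ i : ℕ × ℝ in atTop ×ˢ 𝓟 S, P i.1 i.2) ↔ ∀ᶠ n in atTop, ∀ x ∈ S, P n x :=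
  eventually_prod_principal_iff

theorem eventually_snd_mem (S : Set ℝ) : ∀ᶠ i : ℕ × ℝ in atTop ×ˢ 𝓟 S, i.2 ∈ S :=
  eventually_atTop_prod_principal.2 (Eventually.of_forall fun _ _ hx => hx)

theorem tendsto_sub_of_continuousOn_Icc {α : Type*} {l : Filter α} {F : ℝ → ℝ} {u v : α → ℝ}
    (hF : ContinuousOn F (Icc a b)) (hu : ∀ᶠ i in l, u i ∈ Icc a b)
    (hv : ∀ᶠ i in l, v i ∈ Icc a b) (huv : Tendsto (fun i => u i - v i) l (𝓝 0)) :
    Tendsto (fun i => F (u i) - F (v i)) l (𝓝 0) := by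
  have hU := Metric.uniformContinuousOn_iff.1 (isCompact_Icc.uniformContinuousOn_of_continuous hF)
  rw [Metric.tendsto_nhds] at huv ⊢
  intro ε hε
  obtain ⟨η, hη, h⟩ := hU ε hε
  filter_upwards [hu, hv, huv η hη] with i h1 h2 h3
  have := h _ h1 _ h2 (by simpa [Real.dist_eq] using h3)
  simpa [Real.dist_eq] using this

theorem tendsto_div_of_continuousOn_Icc {α : Type*} {l : Filter α} {F : ℝ → ℝ} {u v : α → ℝ}
    (hF : ContinuousOn F (Icc a b)) (hpos : ∀ x ∈ Icc a b, 0 < F x)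
    (hu : ∀ᶠ i in l, u i ∈ Icc a b)
    (hv : ∀ᶠ i in l, v i ∈ Icc a b) (huv : Tendsto (fun i => u i - v i) l (𝓝 0)) :
    Tendsto (fun i => F (u i) / F (v i)) l (𝓝 1) := by
  have h := tendsto_sub_of_continuousOn_Icc (F := fun x => Real.log (F x))
    (hF.log fun x hx => (hpos x hx).ne') hu hv huv
  have hE := (Real.continuous_exp.tendsto _).comp h
  rw [Real.exp_zero] at hE
  refine hE.congr' ?_
  filter_upwards [hu, hv] with i h1 h2
  rw [Function.comp_apply, Real.exp_sub, Real.exp_log (hpos _ h1), Real.exp_log (hpos _ h2)]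

end UniformFilter

namespace IsContractionOn

variable {f : ℝ → ℝ} {δ C a b : ℝ}

theorem tendsto_iterate_uniform (h : IsContractionOn f δ C) (ha : 0 < a) (hab : a ≤ b)
    (hb : b < δ) :
    Tendsto (fun i : ℕ × ℝ => f^[i.1] i.2) (atTop ×ˢ 𝓟 (Icc a b)) (𝓝[>] 0) := by
  have hbm : b ∈ Ioo 0 δ := ⟨ha.trans_le hab, hb⟩
  have hmem : ∀ᶠ i : ℕ × ℝ in atTop ×ˢ 𝓟 (Icc a b), 0 < f^[i.1] i.2 := by
    filter_upwards [eventually_snd_mem (Icc a b)] with i hi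
    exact (h.iterate_mem ⟨ha.trans_le hi.1, hi.2.trans_lt hb⟩ _).1
  refine tendsto_nhdsWithin_iff.2 ⟨?_, hmem⟩
  refine squeeze_zero' (hmem.mono fun i hi => hi.le) ?_
    ((h.tendsto_iterate hbm).comp tendsto_fst)
  filter_upwards [eventually_snd_mem (Icc a b)] with i hi
  exact (h.strictMono.iterate i.1).monotone hi.2

end IsContractionOn

namespace IsAbelCoordinate

variable {f w τ : ℝ → ℝ} {δ κ C a b : ℝ}

theorem map_iterate (h : IsAbelCoordinate f w τ δ κ) (hf : IsContractionOn f δ C) {x : ℝ}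
    (hx : x ∈ Ioo 0 δ) (n : ℕ) : τ (f^[n] x) = τ x - n * κ := by
  induction n with
  | zero => simp
  | succ n ih =>
    rw [Function.iterate_succ_apply', h.map _ (hf.iterate_mem hx n), ih]
    push_cast
    ring

theorem density_map_iterate (h : IsAbelCoordinate f w τ δ κ) (hf : IsContractionOn f δ C) {x : ℝ}
    (hx : x ∈ Ioo 0 δ) (n : ℕ) : w (f^[n] x) * deriv (f^[n]) x = w x := by
  induction n with
  | zero => simp
  | succ n ih =>
    have hd : deriv (f^[n + 1]) x = deriv f (f^[n] x) * deriv (f^[n]) x := by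
      rw [Function.iterate_succ', deriv_comp x (hf.differentiable _)
        ((hf.differentiable.iterate n) x)]
    rw [hd, ← mul_assoc, Function.iterate_succ_apply',
      h.density_map _ (hf.iterate_mem hx n), ih]

/-- Ratios of points of two orbits converge, uniformly on compact sets. -/
theorem tendsto_iterate_ratio (h : IsAbelCoordinate f w τ δ κ) (hf : IsContractionOn f δ C)
    (ha : 0 < a) (hab : a ≤ b) (hb : b < δ) {β : ℝ}
    (hβ : Tendsto (fun x => (w x * x)⁻¹) (𝓝[>] 0) (𝓝 β)) :
    Tendsto (fun i : ℕ × ℝ => f^[i.1] i.2 / f^[i.1] a / Real.exp (β * (τ i.2 - τ a)))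
      (atTop ×ˢ 𝓟 (Icc a b)) (𝓝 1) := by
  have hsub : Icc a b ⊆ Ioo 0 δ := fun x hx => ⟨ha.trans_le hx.1, hx.2.trans_lt hb⟩
  have haδ : a ∈ Ioo 0 δ := hsub (left_mem_Icc.2 hab)
  have hex : ∀ᶠ i : ℕ × ℝ in atTop ×ˢ 𝓟 (Icc a b), ∃ ξ, ξ ∈ uIcc (f^[i.1] a) (f^[i.1] i.2) ∧
      τ (f^[i.1] i.2) - τ (f^[i.1] a) =
        w ξ * ξ * (Real.log (f^[i.1] i.2) - Real.log (f^[i.1] a)) := by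
    filter_upwards [eventually_snd_mem (Icc a b)] with i hi
    exact h.exists_sub_eq_log (hf.iterate_mem haδ _) (hf.iterate_mem (hsub hi) _)
  have hYa : Tendsto (fun i : ℕ × ℝ => f^[i.1] a) (atTop ×ˢ 𝓟 (Icc a b)) (𝓝[>] 0) :=
    tendsto_nhdsWithin_iff.2 ⟨(hf.tendsto_iterate haδ).comp tendsto_fst,
      Eventually.of_forall fun i => (hf.iterate_mem haδ _).1⟩
  have : (atTop ×ˢ 𝓟 (Icc a b) : Filter (ℕ × ℝ)).NeBot := by
    have : (𝓟 (Icc a b)).NeBot := principal_neBot_iff.2 ⟨a, left_mem_Icc.2 hab⟩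
    infer_instance
  obtain ⟨ξ, hξ⟩ := hex.choice
  have hξ0 : Tendsto ξ (atTop ×ˢ 𝓟 (Icc a b)) (𝓝[>] 0) :=
    tendsto_nhdsGT_of_mem_uIcc hYa (hf.tendsto_iterate_uniform ha hab hb)
      (hξ.mono fun i hi => hi.1)
  have hβξ : Tendsto (fun i => |(w (ξ i) * ξ i)⁻¹ - β| * (τ b - τ a))
      (atTop ×ˢ 𝓟 (Icc a b)) (𝓝 0) := by
    have := (((hβ.comp hξ0).sub_const β).abs).mul_const (τ b - τ a)
    simpa using this
  have hlog : Tendsto (fun i : ℕ × ℝ => Real.log (f^[i.1] i.2) - Real.log (f^[i.1] a)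
      - β * (τ i.2 - τ a)) (atTop ×ˢ 𝓟 (Icc a b)) (𝓝 0) := by
    refine squeeze_zero_norm' ?_ hβξ
    filter_upwards [hξ, eventually_snd_mem (Icc a b), hξ0 (Ioo_mem_nhdsGT (haδ.1.trans haδ.2))]
      with i hi hx hξi
    have hpos : 0 < w (ξ i) * ξ i := mul_pos (h.pos _ hξi) hξi.1
    have h1 := hi.2
    rw [h.map_iterate hf (hsub hx), h.map_iterate hf haδ] at h1
    -- Both orbits are translated by the same amount in the Abel coordinate, so `τ i.2 - τ a` is
    -- unchanged by iteration; only the conversion factor `(w ξ * ξ)⁻¹` varies, and it tends to `β`.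
    have h2 : Real.log (f^[i.1] i.2) - Real.log (f^[i.1] a) - β * (τ i.2 - τ a)
        = ((w (ξ i) * ξ i)⁻¹ - β) * (τ i.2 - τ a) := by
      rw [sub_mul, show τ i.2 - τ a = w (ξ i) * ξ i *
        (Real.log (f^[i.1] i.2) - Real.log (f^[i.1] a)) by linarith,
        inv_mul_cancel_left₀ hpos.ne']
    have h3 : τ a ≤ τ i.2 := h.strictMonoOn.monotoneOn haδ (hsub hx) hx.1
    have h4 : τ i.2 ≤ τ b := h.strictMonoOn.monotoneOn (hsub hx) (hsub (right_mem_Icc.2 hab)) hx.2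
    rw [h2, Real.norm_eq_abs, abs_mul, abs_of_nonneg (sub_nonneg.2 h3)]
    exact mul_le_mul_of_nonneg_left (by linarith) (abs_nonneg _)
  have hE := (Real.continuous_exp.tendsto _).comp hlog
  rw [Real.exp_zero] at hE
  refine hE.congr' ?_
  filter_upwards [eventually_snd_mem (Icc a b)] with i hx
  rw [Function.comp_apply, Real.exp_sub, Real.exp_sub, Real.exp_log (hf.iterate_mem haδ _).1,
    Real.exp_log (hf.iterate_mem (hsub hx) _).1]

section Conjugates

variable {g : ℝ → ℝ} {k : ℕ → ℝ → ℝ} {d c : ℝ}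

/-- If `k n` is the conjugate of `g` by the `n`-th iterate of `f`, then its displacement in the
Abel coordinate is that of `g` near `0`. -/
theorem eventually_conj_mem (h : IsAbelCoordinate f w τ δ κ) (hf : IsContractionOn f δ C)
    (ha : 0 < a) (hab : a ≤ b) (hbd : b < d) (hd : d < δ)
    (hg : Tendsto g (𝓝[>] 0) (𝓝[>] 0)) (hk : ∀ n x, f^[n] (k n x) = g (f^[n] x))
    (hk0 : ∀ n x, 0 < x → 0 < k n x)
    (hc : Tendsto (fun x => τ (g x) - τ x) (𝓝[>] 0) (𝓝 c)) (hcd : c < τ d - τ b) :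
    ∀ᶠ i : ℕ × ℝ in atTop ×ˢ 𝓟 (Icc a b), k i.1 i.2 ∈ Ioo 0 d ∧
      τ (k i.1 i.2) - τ i.2 = τ (g (f^[i.1] i.2)) - τ (f^[i.1] i.2) := by
  have hY := hf.tendsto_iterate_uniform ha hab (hbd.trans hd)
  have hδ : 0 < δ := by linarith
  have hdδ : d ∈ Ioo 0 δ := ⟨by linarith, hd⟩
  filter_upwards [eventually_snd_mem (Icc a b), (hc.comp hY).eventually_lt_const hcd,
    (hg.comp hY).eventually (Ioo_mem_nhdsGT hδ)] with i hi h1 h2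
  simp only [Function.comp_apply] at h1 h2
  have hiδ : i.2 ∈ Ioo 0 δ := ⟨ha.trans_le hi.1, hi.2.trans_lt (hbd.trans hd)⟩
  have hτb : τ i.2 ≤ τ b :=
    h.strictMonoOn.monotoneOn hiδ ⟨by linarith, by linarith⟩ hi.2
  have hkpos := hk0 i.1 i.2 hiδ.1
  have hlt : k i.1 i.2 < d := by
    -- If `k` sent the point to `d` or beyond, its Abel displacement would be at least `τ d - τ b`,
    -- contrary to the bound on the displacement of `g` near `0`.
    by_contra! hle
    have h3 : f^[i.1] d ≤ f^[i.1] (k i.1 i.2) := (hf.strictMono.iterate i.1).monotone hle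
    rw [hk] at h3
    have h4 := h.strictMonoOn.monotoneOn (hf.iterate_mem hdδ i.1) h2 h3
    rw [h.map_iterate hf hdδ] at h4
    rw [h.map_iterate hf hiδ] at h1
    linarith
  refine ⟨⟨hkpos, hlt⟩, ?_⟩
  rw [← hk, h.map_iterate hf ⟨hkpos, hlt.trans hd⟩, h.map_iterate hf hiδ]
  ring

/-- Differentiate `f^[n] ∘ k n = g ∘ f^[n]`; since `f` preserves the density `w`, the Jacobian of `k
n` relative to `w` is that of `g` at the iterated point. -/
theorem deriv_conj_mul_density (h : IsAbelCoordinate f w τ δ κ) (hf : IsContractionOn f δ C)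
    (hg : Differentiable ℝ g) (hkd : ∀ n, Differentiable ℝ (k n))
    (hk : ∀ n x, f^[n] (k n x) = g (f^[n] x)) {n : ℕ} {x : ℝ} (hx : x ∈ Ioo 0 δ)
    (hkx : k n x ∈ Ioo 0 δ) :
    deriv (k n) x * w (k n x) / w x
      = deriv g (f^[n] x) * w (g (f^[n] x)) / w (f^[n] x) := by
  have hcomp : f^[n] ∘ k n = g ∘ f^[n] := funext fun x => hk n x
  have hfd := hf.differentiable.iterate n
  have h1 : deriv (f^[n]) (k n x) * deriv (k n) x = deriv g (f^[n] x) * deriv (f^[n]) x := by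
    rw [← deriv_comp x (hfd _) (hkd n x), ← deriv_comp x (hg _) (hfd _), hcomp]
  have h2 := h.density_map_iterate hf hx n
  have h3 := h.density_map_iterate hf hkx n
  rw [hk] at h3
  have hw1 := h.pos x hx
  have hw2 := h.pos _ (hf.iterate_mem hx n)
  rw [div_eq_div_iff hw1.ne' hw2.ne', ← h3]
  calc deriv (k n) x * (w (g (f^[n] x)) * deriv f^[n] (k n x)) * w (f^[n] x)
      = w (g (f^[n] x)) * (deriv (f^[n]) (k n x) * deriv (k n) x) * w (f^[n] x) := by ring
    _ = deriv g (f^[n] x) * w (g (f^[n] x)) * (w (f^[n] x) * deriv (f^[n]) x) := by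
      rw [h1]; ring
    _ = deriv g (f^[n] x) * w (g (f^[n] x)) * w x := by rw [h2]

theorem tendsto_deriv_conj (h : IsAbelCoordinate f w τ δ κ) (hf : IsContractionOn f δ C)
    (ha : 0 < a) (hab : a ≤ b) (hbd : b < d) (hd : d < δ)
    (hgd : Differentiable ℝ g) (hkd : ∀ n, Differentiable ℝ (k n))
    (hk : ∀ n x, f^[n] (k n x) = g (f^[n] x))
    (hmem : ∀ᶠ i : ℕ × ℝ in atTop ×ˢ 𝓟 (Icc a b), k i.1 i.2 ∈ Ioo 0 d)
    (hB : Tendsto (fun x => deriv g x * w (g x) / w x) (𝓝[>] 0) (𝓝 1)) :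
    Tendsto (fun i : ℕ × ℝ => deriv (k i.1) i.2 * w (k i.1 i.2) / w i.2)
      (atTop ×ˢ 𝓟 (Icc a b)) (𝓝 1) := by
  refine (hB.comp (hf.tendsto_iterate_uniform ha hab (hbd.trans hd))).congr' ?_
  filter_upwards [eventually_snd_mem (Icc a b), hmem] with i hi hki
  exact (h.deriv_conj_mul_density hf hgd hkd hk
    ⟨ha.trans_le hi.1, hi.2.trans_lt (hbd.trans hd)⟩ ⟨hki.1, hki.2.trans hd⟩).symm

end Conjugates

/-- Asymptotics of displacements in the Abel coordinate give asymptotics of displacements. -/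
theorem tendsto_displacement_div (h : IsAbelCoordinate f w τ δ κ)
    (ha : 0 < a) (hab : a ≤ b) {d : ℝ} (hbd : b < d) (hd : d < δ) {k : ℕ → ℝ → ℝ} {ε : ℕ → ℝ}
    {θ : ℝ → ℝ} (hε : ∀ n, 0 < ε n) (hε0 : Tendsto ε atTop (𝓝 0))
    (hθ : ContinuousOn θ (Icc a b)) (hθ0 : ∀ x ∈ Icc a b, 0 < θ x)
    (hmem : ∀ᶠ i : ℕ × ℝ in atTop ×ˢ 𝓟 (Icc a b), k i.1 i.2 ∈ Ioo 0 d)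
    (hdisp : Tendsto (fun i : ℕ × ℝ => (τ (k i.1 i.2) - τ i.2) / (ε i.1 * θ i.2))
      (atTop ×ˢ 𝓟 (Icc a b)) (𝓝 1))
    (hderiv : Tendsto (fun i : ℕ × ℝ => deriv (k i.1) i.2 * w (k i.1 i.2) / w i.2)
      (atTop ×ˢ 𝓟 (Icc a b)) (𝓝 1)) :
    Tendsto (fun i : ℕ × ℝ => (k i.1 i.2 - i.2) / (ε i.1 * (θ i.2 / w i.2)))
      (atTop ×ˢ 𝓟 (Icc a b)) (𝓝 1) ∧
    Tendsto (fun i : ℕ × ℝ => deriv (k i.1) i.2) (atTop ×ˢ 𝓟 (Icc a b)) (𝓝 1) := by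
  set l : Filter (ℕ × ℝ) := atTop ×ˢ 𝓟 (Icc a b)
  have hIcc : ∀ᶠ i : ℕ × ℝ in l, i.2 ∈ Icc a b := eventually_snd_mem (Icc a b)
  have : l.NeBot := by
    have : (𝓟 (Icc a b)).NeBot := principal_neBot_iff.2 ⟨a, left_mem_Icc.2 hab⟩
    infer_instance
  have hsub : Icc a d ⊆ Ioo 0 δ := fun x hx => ⟨ha.trans_le hx.1, hx.2.trans_lt hd⟩
  have hwc : ContinuousOn w (Icc a d) := h.continuousOn.mono hsub
  have hw0 : ∀ x ∈ Icc a d, 0 < w x := fun x hx => h.pos x (hsub hx)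
  obtain ⟨M, hM⟩ := isCompact_Icc.exists_bound_of_continuousOn hθ
  have hτ0 : Tendsto (fun i : ℕ × ℝ => τ (k i.1 i.2) - τ i.2) l (𝓝 0) := by
    have h1 : Tendsto (fun i : ℕ × ℝ => ε i.1 * θ i.2) l (𝓝 0) := by
      have h2 : Tendsto (fun i : ℕ × ℝ => ε i.1 * M) l (𝓝 0) := by
        simpa using (hε0.comp tendsto_fst).mul_const M
      refine squeeze_zero_norm' ?_ h2
      filter_upwards [hIcc] with i hi
      rw [norm_mul, Real.norm_of_nonneg (hε i.1).le]
      exact mul_le_mul_of_nonneg_left (hM _ hi) (hε i.1).le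
    have h3 := hdisp.mul h1
    rw [mul_zero] at h3
    refine h3.congr' ?_
    filter_upwards [hIcc] with i hi
    exact div_mul_cancel₀ _ (mul_pos (hε _) (hθ0 _ hi)).ne'
  have hge : ∀ᶠ i : ℕ × ℝ in l, i.2 < k i.1 i.2 := by
    filter_upwards [hIcc, hmem, hdisp.eventually_const_lt one_pos] with i hi hki hpos
    have := (div_pos_iff_of_pos_right (mul_pos (hε i.1) (hθ0 _ hi))).1 hpos
    refine (h.strictMonoOn.lt_iff_lt (hsub ⟨hi.1, hi.2.trans hbd.le⟩)
      ⟨hki.1, hki.2.trans hd⟩).1 (by linarith)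
  have hkIcc : ∀ᶠ i : ℕ × ℝ in l, k i.1 i.2 ∈ Icc a d := by
    filter_upwards [hIcc, hmem, hge] with i h1 h2 h3
    exact ⟨h1.1.trans h3.le, h2.2.le⟩
  have hiIcc : ∀ᶠ i : ℕ × ℝ in l, i.2 ∈ Icc a d := hIcc.mono fun i hi => ⟨hi.1, hi.2.trans hbd.le⟩
  have hex : ∀ᶠ i : ℕ × ℝ in l, ∃ ξ, ξ ∈ uIcc i.2 (k i.1 i.2) ∧
      τ (k i.1 i.2) - τ i.2 = w ξ * (k i.1 i.2 - i.2) := by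
    filter_upwards [hiIcc, hkIcc] with i h1 h2
    exact h.exists_sub_eq (hsub h1) (hsub h2)
  obtain ⟨ξ, hξ⟩ := hex.choice
  have hξIcc : ∀ᶠ i : ℕ × ℝ in l, ξ i ∈ Icc a d := by
    filter_upwards [hiIcc, hkIcc, hξ] with i h1 h2 h3
    exact ordConnected_Icc.uIcc_subset h1 h2 h3.1
  -- A positive lower bound for `w` on `[a, d]` makes the displacement tend to `0` along with the
  -- Abel displacement.
  obtain ⟨m, hm, hmin⟩ := isCompact_Icc.exists_isMinOn
    (nonempty_Icc.2 (hab.trans hbd.le)) hwc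
  have hk0 : Tendsto (fun i : ℕ × ℝ => k i.1 i.2 - i.2) l (𝓝 0) := by
    have h1 := hτ0.div_const (w m)
    rw [zero_div] at h1
    refine squeeze_zero' (hge.mono fun i hi => (sub_pos.2 hi).le) ?_ h1
    filter_upwards [hξ, hξIcc, hge] with i h2 h3 h4
    rw [le_div_iff₀ (hw0 m hm), h2.2, mul_comm]
    exact mul_le_mul_of_nonneg_right (hmin h3) (sub_pos.2 h4).le
  have hξ0 : Tendsto (fun i => ξ i - i.2) l (𝓝 0) := by
    refine squeeze_zero' ?_ ?_ hk0
    · filter_upwards [hξ, hge] with i h2 h4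
      have := h2.1
      rw [uIcc_of_le h4.le] at this
      linarith [this.1]
    · filter_upwards [hξ, hge] with i h2 h4
      have := h2.1
      rw [uIcc_of_le h4.le] at this
      linarith [this.2]
  have hwξ := tendsto_div_of_continuousOn_Icc hwc hw0 hξIcc hiIcc hξ0
  have hwk := tendsto_div_of_continuousOn_Icc hwc hw0 hkIcc hiIcc hk0
  constructor
  · have := hdisp.div hwξ one_ne_zero
    rw [div_one] at this
    refine this.congr' ?_
    filter_upwards [hξ, hξIcc, hIcc, hiIcc] with i h1 h2 h3 h4
    have := hw0 _ h2
    have := hw0 _ h4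
    have := hθ0 _ h3
    have := hε i.1
    rw [Pi.div_apply, h1.2]
    field_simp
  · have := hderiv.div hwk one_ne_zero
    rw [div_one] at this
    refine this.congr' ?_
    filter_upwards [hkIcc, hiIcc] with i h2 h4
    have := hw0 _ h2
    have := hw0 _ h4
    rw [Pi.div_apply]
    field_simp

end IsAbelCoordinate

end CircleDiff

/-! ### Construction of group elements approximating a vector field -/

namespace CircleDiff

/-- A faithful action of `G` on the line by increasing analytic diffeomorphisms fixing `0`. -/
structure IsAnalyticAction {G : Type*} [Group G] (ρ : G →* Equiv.Perm ℝ) : Prop where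
  analytic : ∀ g, AnalyticOnNhd ℝ (ρ g) univ
  deriv_pos : ∀ g x, 0 < deriv (ρ g) x
  map_zero : ∀ g, ρ g 0 = 0
  injective : Function.Injective ρ

namespace IsAnalyticAction

variable {G : Type*} [Group G] {ρ : G →* Equiv.Perm ℝ}

theorem contDiff (hρ : IsAnalyticAction ρ) (g : G) : ContDiff ℝ 2 (ρ g) :=
  contDiffOn_univ.1 ((hρ.analytic g).contDiffOn uniqueDiffOn_univ)

theorem differentiable (hρ : IsAnalyticAction ρ) (g : G) : Differentiable ℝ (ρ g) :=
  (hρ.contDiff g).differentiable (by norm_num)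

theorem strictMono (hρ : IsAnalyticAction ρ) (g : G) : StrictMono (ρ g) :=
  strictMono_of_deriv_pos (hρ.deriv_pos g)

theorem pos (hρ : IsAnalyticAction ρ) (g : G) {x : ℝ} (hx : 0 < x) : 0 < ρ g x := by
  have := hρ.strictMono g hx
  rwa [hρ.map_zero] at this

theorem tendsto_nhdsGT (hρ : IsAnalyticAction ρ) (g : G) : Tendsto (ρ g) (𝓝[>] 0) (𝓝[>] 0) :=
  tendsto_nhdsGT_zero_of_strictMono (hρ.contDiff g).continuous (hρ.strictMono g) (hρ.map_zero g)

theorem tendsto_div_self (hρ : IsAnalyticAction ρ) (g : G) :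
    Tendsto (fun x => ρ g x / x) (𝓝[>] 0) (𝓝 (deriv (ρ g) 0)) :=
  tendsto_div_self_of_hasDerivAt (hρ.map_zero g) (hρ.differentiable g 0).hasDerivAt

theorem tendsto_deriv (hρ : IsAnalyticAction ρ) (g : G) :
    Tendsto (deriv (ρ g)) (𝓝[>] 0) (𝓝 (deriv (ρ g) 0)) :=
  (((hρ.contDiff g).continuous_deriv (by norm_num)).tendsto 0).mono_left nhdsWithin_le_nhds

theorem exists_hasLeadingTerm (hρ : IsAnalyticAction ρ) {g : G} (hg : g ≠ 1) :
    ∃ r b, 1 ≤ r ∧ b ≠ 0 ∧ HasLeadingTerm (ρ g) r b := by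
  refine CircleDiff.exists_hasLeadingTerm (hρ.analytic g 0 (mem_univ _)) (hρ.map_zero g)
    fun hev => hg (hρ.injective ?_)
  have := (hρ.analytic g).eq_of_eventuallyEq analyticOnNhd_id (z₀ := 0) hev
  ext x
  rw [this, map_one]
  rfl

theorem apply_inv (ρ : G →* Equiv.Perm ℝ) (g : G) (x : ℝ) : ρ g (ρ g⁻¹ x) = x := by
  rw [← Equiv.Perm.mul_apply, ← map_mul, mul_inv_cancel, map_one]
  rfl

theorem exists_hasLeadingTerm_inv (hρ : IsAnalyticAction ρ) {g : G} {r : ℕ} {b : ℝ}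
    (h : HasLeadingTerm (ρ g) r b) : ∃ s, 0 < s ∧ HasLeadingTerm (ρ g⁻¹) r (-(b * s)) :=
  ⟨_, pow_pos (hρ.deriv_pos g⁻¹ 0) r,
    h.inv (apply_inv ρ g) (hρ.tendsto_nhdsGT g⁻¹)
      (hρ.tendsto_div_self g⁻¹)⟩

/-- A contraction of minimal order at `0`. -/
theorem exists_minimal_contraction [Nontrivial G] (hρ : IsAnalyticAction ρ) :
    ∃ (f : G) (q : ℕ) (b : ℝ), 1 ≤ q ∧ b < 0 ∧ HasLeadingTerm (ρ f) q b ∧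
      ∀ g : G, g ≠ 1 → ∃ r b, q ≤ r ∧ b ≠ 0 ∧ HasLeadingTerm (ρ g) r b := by
  classical
  obtain ⟨g₀, hg₀⟩ := exists_ne (1 : G)
  have hex : ∃ r, 1 ≤ r ∧ ∃ (g : G) (b : ℝ), b ≠ 0 ∧ HasLeadingTerm (ρ g) r b := by
    obtain ⟨r, b, hr, hb, h⟩ := hρ.exists_hasLeadingTerm hg₀
    exact ⟨r, hr, g₀, b, hb, h⟩
  have hmin : ∀ g : G, g ≠ 1 → ∃ r b, Nat.find hex ≤ r ∧ b ≠ 0 ∧ HasLeadingTerm (ρ g) r b := by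
    intro g hg
    obtain ⟨r, b, hr, hb, h⟩ := hρ.exists_hasLeadingTerm hg
    exact ⟨r, b, Nat.find_min' hex ⟨hr, g, b, hb, h⟩, hb, h⟩
  obtain ⟨hq, g, b, hb, hg⟩ := Nat.find_spec hex
  rcases hb.lt_or_gt with hb | hb
  · exact ⟨g, _, b, hq, hb, hg, hmin⟩
  · obtain ⟨s, hs, h⟩ := hρ.exists_hasLeadingTerm_inv hg
    -- An expansion is replaced by its inverse, which has the same order and a leading coefficient
    -- of opposite sign.
    exact ⟨g⁻¹, _, _, hq, neg_neg_of_pos (mul_pos hb hs), h, hmin⟩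

section Conjugates

variable {f : G} {w τ : ℝ → ℝ} {δ κ C a b d : ℝ}

theorem iterate_conj (ρ : G →* Equiv.Perm ℝ) (f g : G) (n : ℕ) (x : ℝ) :
    (ρ f)^[n] (ρ ((f ^ n)⁻¹ * g * f ^ n) x) = ρ g ((ρ f)^[n] x) := by
  rw [Equiv.Perm.iterate_eq_pow, ← map_pow, ← Equiv.Perm.mul_apply, ← Equiv.Perm.mul_apply,
    ← map_mul, ← map_mul]
  congr 2
  group

theorem eventually_conj (hρ : IsAnalyticAction ρ) (h : IsAbelCoordinate (ρ f) w τ δ κ)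
    (hf : IsContractionOn (ρ f) δ C) (ha : 0 < a) (hab : a < b) (hbd : b < d) (hd : d < δ)
    (g : G) {c : ℝ} (hc : Tendsto (fun x => τ (ρ g x) - τ x) (𝓝[>] 0) (𝓝 c))
    (hcd : c < τ d - τ b) :
    ∀ᶠ i : ℕ × ℝ in atTop ×ˢ 𝓟 (Icc a b),
      ρ ((f ^ i.1)⁻¹ * g * f ^ i.1) i.2 ∈ Ioo 0 d ∧
      τ (ρ ((f ^ i.1)⁻¹ * g * f ^ i.1) i.2) - τ i.2
        = τ (ρ g ((ρ f)^[i.1] i.2)) - τ ((ρ f)^[i.1] i.2) :=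
  h.eventually_conj_mem hf ha hab.le hbd hd (hρ.tendsto_nhdsGT g)
    (k := fun n x => ρ ((f ^ n)⁻¹ * g * f ^ n) x) (iterate_conj ρ f g)
    (fun _ _ hx => hρ.pos _ hx) hc hcd

theorem tendsto_deriv_conj (hρ : IsAnalyticAction ρ) (h : IsAbelCoordinate (ρ f) w τ δ κ)
    (hf : IsContractionOn (ρ f) δ C) (ha : 0 < a) (hab : a < b) (hbd : b < d) (hd : d < δ)
    (g : G) {c : ℝ} (hc : Tendsto (fun x => τ (ρ g x) - τ x) (𝓝[>] 0) (𝓝 c))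
    (hcd : c < τ d - τ b)
    (hB : Tendsto (fun x => deriv (ρ g) x * w (ρ g x) / w x) (𝓝[>] 0) (𝓝 1)) :
    Tendsto (fun i : ℕ × ℝ => deriv (ρ ((f ^ i.1)⁻¹ * g * f ^ i.1)) i.2
      * w (ρ ((f ^ i.1)⁻¹ * g * f ^ i.1) i.2) / w i.2) (atTop ×ˢ 𝓟 (Icc a b)) (𝓝 1) :=
  h.tendsto_deriv_conj hf ha hab.le hbd hd (hρ.differentiable g)
    (k := fun n x => ρ ((f ^ n)⁻¹ * g * f ^ n) x) (fun _ => hρ.differentiable _)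
    (iterate_conj ρ f g)
    ((hρ.eventually_conj h hf ha hab hbd hd g hc hcd).mono fun _ hi => hi.1) hB

end Conjugates

/-- Elements `k n` of the group whose displacements on `[a, b]` are equivalent to `ε n • X`, and
whose derivatives tend to `1` there. -/
structure IsApproximation (ρ : G →* Equiv.Perm ℝ) (a b : ℝ) (X : ℝ → ℝ) (k : ℕ → G)
    (ε : ℕ → ℝ) : Prop where
  continuousOn : ContinuousOn X (Icc a b)
  pos : ∀ x ∈ Icc a b, 0 < X x
  eps_pos : ∀ n, 0 < ε n
  eps_tendsto : Tendsto ε atTop (𝓝 0)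
  ne_one : ∀ n, k n ≠ 1
  displacement : Tendsto (fun i : ℕ × ℝ => (ρ (k i.1) i.2 - i.2) / (ε i.1 * X i.2))
    (atTop ×ˢ 𝓟 (Icc a b)) (𝓝 1)
  deriv : Tendsto (fun i : ℕ × ℝ => deriv (ρ (k i.1)) i.2) (atTop ×ˢ 𝓟 (Icc a b)) (𝓝 1)

section Approximation

variable {f : G} {w τ : ℝ → ℝ} {δ κ C a b d : ℝ}

theorem isApproximation_of_abel (h : IsAbelCoordinate (ρ f) w τ δ κ)
    (ha : 0 < a) (hab : a < b) (hbd : b < d) (hd : d < δ) {k : ℕ → G} {ε : ℕ → ℝ}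
    {θ : ℝ → ℝ} (hε : ∀ n, 0 < ε n) (hε0 : Tendsto ε atTop (𝓝 0))
    (hθ : ContinuousOn θ (Icc a b)) (hθ0 : ∀ x ∈ Icc a b, 0 < θ x) (hk1 : ∀ n, k n ≠ 1)
    (hmem : ∀ᶠ i : ℕ × ℝ in atTop ×ˢ 𝓟 (Icc a b), ρ (k i.1) i.2 ∈ Ioo 0 d)
    (hdisp : Tendsto (fun i : ℕ × ℝ => (τ (ρ (k i.1) i.2) - τ i.2) / (ε i.1 * θ i.2))
      (atTop ×ˢ 𝓟 (Icc a b)) (𝓝 1))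
    (hderiv : Tendsto (fun i : ℕ × ℝ => deriv (ρ (k i.1)) i.2 * w (ρ (k i.1) i.2) / w i.2)
      (atTop ×ˢ 𝓟 (Icc a b)) (𝓝 1)) :
    IsApproximation ρ a b (fun x => θ x / w x) k ε := by
  have hsub : Icc a b ⊆ Ioo 0 δ := fun x hx => ⟨ha.trans_le hx.1, by linarith [hx.2]⟩
  have hlim := h.tendsto_displacement_div ha hab.le hbd hd (k := fun n x => ρ (k n) x) hε hε0
    hθ hθ0 hmem hdisp hderiv
  exact ⟨hθ.div (h.continuousOn.mono hsub) fun x hx => (h.pos x (hsub hx)).ne',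
    fun x hx => div_pos (hθ0 x hx) (h.pos x (hsub hx)), hε, hε0, hk1, hlim.1, hlim.2⟩

/-- An element of higher order, conjugated by the powers of the contraction. -/
theorem exists_isApproximation_of_higher_order (hρ : IsAnalyticAction ρ)
    (h : IsAbelCoordinate (ρ f) w τ δ κ)
    (hf : IsContractionOn (ρ f) δ C) (ha : 0 < a) (hab : a < b) (hbd : b < d) (hd : d < δ)
    {β : ℝ} (hβ : Tendsto (fun x => (w x * x)⁻¹) (𝓝[>] 0) (𝓝 β))
    {g : G} (hg : g ≠ 1)
    (hB : Tendsto (fun x => deriv (ρ g) x * w (ρ g x) / w x) (𝓝[>] 0) (𝓝 1))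
    {m : ℕ} (hm : m ≠ 0) {c : ℝ} (hc : 0 < c)
    (hD : Tendsto (fun x => (τ (ρ g x) - τ x) / x ^ m) (𝓝[>] 0) (𝓝 c)) :
    ∃ X k ε, IsApproximation ρ a b X k ε := by
  have hsub : Icc a b ⊆ Ioo 0 δ := fun x hx => ⟨ha.trans_le hx.1, by linarith [hx.2]⟩
  have haδ : a ∈ Ioo 0 δ := hsub (left_mem_Icc.2 hab.le)
  have hbd' : τ b < τ d :=
    h.strictMonoOn (hsub (right_mem_Icc.2 hab.le)) ⟨by linarith, hd⟩ hbd
  have hD0 : Tendsto (fun x => τ (ρ g x) - τ x) (𝓝[>] 0) (𝓝 0) := by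
    have h1 : Tendsto (fun x : ℝ => x ^ m) (𝓝[>] 0) (𝓝 (0 ^ m)) :=
      ((continuous_pow m).tendsto 0).mono_left nhdsWithin_le_nhds
    have h2 := hD.mul h1
    rw [zero_pow hm, mul_zero] at h2
    refine h2.congr' ?_
    filter_upwards [self_mem_nhdsWithin] with x hx
    exact div_mul_cancel₀ _ (pow_pos hx m).ne'
  have hcd : (0 : ℝ) < τ d - τ b := by linarith
  have hmem := hρ.eventually_conj h hf ha hab hbd hd g hD0 hcd
  have hY := hf.tendsto_iterate_uniform ha hab.le (hbd.trans hd)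
  -- The Abel displacement of the conjugate is `~ c * (fⁿ x) ^ m`. Comparing the orbit of `x` with
  -- that of `a` splits it into `ε n = c * (fⁿ a) ^ m` and the `m`-th power of the limiting ratio.
  refine ⟨_, _, _, isApproximation_of_abel h ha hab hbd hd
    (k := fun n => (f ^ n)⁻¹ * g * f ^ n) (ε := fun n => c * ((ρ f)^[n] a) ^ m)
    (θ := fun x => Real.exp (β * (τ x - τ a)) ^ m)
    (fun n => mul_pos hc (pow_pos (hf.iterate_mem haδ n).1 m)) ?_ ?_
    (fun x _ => pow_pos (Real.exp_pos _) m) (fun n hn => hg ?_) (hmem.mono fun i hi => hi.1) ?_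
    (hρ.tendsto_deriv_conj h hf ha hab hbd hd g hD0 hcd hB)⟩
  · have := ((hf.tendsto_iterate haδ).pow m).const_mul c
    rwa [zero_pow hm, mul_zero] at this
  · have hτc : ContinuousOn τ (Icc a b) := fun x hx =>
      (h.hasDerivAt x (hsub hx)).continuousAt.continuousWithinAt
    exact ((continuousOn_const.mul (hτc.sub continuousOn_const)).rexp).pow m
  · rw [mul_assoc, inv_mul_eq_one, eq_comm, mul_eq_right] at hn
    exact hn
  · have h1 := (hD.comp hY).div_const c
    rw [div_self hc.ne'] at h1
    have h2 := h1.mul ((h.tendsto_iterate_ratio hf ha hab.le (hbd.trans hd) hβ).pow m)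
    rw [one_pow, one_mul] at h2
    refine h2.congr' ?_
    filter_upwards [hmem, eventually_snd_mem (Icc a b)] with i hi hiab
    have hp1 := (hf.iterate_mem haδ i.1).1
    have hp2 := (hf.iterate_mem (hsub hiab) i.1).1
    rw [hi.2, Function.comp_apply, div_pow, div_pow]
    field_simp

/-- If the displacements in the Abel coordinate have nonzero limits, the limit is an injective
homomorphism to `ℝ`, so that it takes arbitrarily small values unless the group is cyclic. -/
theorem exists_small_translation (hρ : IsAnalyticAction ρ)
    (hD : ∀ g : G, g ≠ 1 → ∃ c, c ≠ 0 ∧ Tendsto (fun x => τ (ρ g x) - τ x) (𝓝[>] 0) (𝓝 c))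
    (hG : ¬ IsCyclic G) {η : ℝ} (hη : 0 < η) :
    ∃ (g : G) (c : ℝ), g ≠ 1 ∧ 0 < c ∧ c < η ∧
      Tendsto (fun x => τ (ρ g x) - τ x) (𝓝[>] 0) (𝓝 c) := by
  have hD' : ∀ g : G, ∃ c, (g ≠ 1 → c ≠ 0) ∧
      Tendsto (fun x => τ (ρ g x) - τ x) (𝓝[>] 0) (𝓝 c) := by
    intro g
    by_cases hg : g = 1
    · refine ⟨0, fun h => absurd hg h, ?_⟩
      simp [hg]
    · obtain ⟨c, h1, h2⟩ := hD g hg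
      exact ⟨c, fun _ => h1, h2⟩
  choose χ hχ1 hχ using hD'
  -- The displacement of `g * k` at `x` is that of `g` at `k x` plus that of `k` at `x`, and `k x →
  -- 0⁺`.
  have hmul : ∀ g k, χ (g * k) = χ g + χ k := fun g k => by
    refine tendsto_nhds_unique (hχ (g * k)) ((((hχ g).comp (hρ.tendsto_nhdsGT k)).add
      (hχ k)).congr fun x => ?_)
    simp
  let φ : Additive G →+ ℝ := AddMonoidHom.mk' (fun g => χ g.toMul) fun g k => hmul _ _
  have hinj : ∀ g k, χ g = χ k → g = k := fun g k hgk => by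
    by_contra hne
    refine hχ1 (g * k⁻¹) (fun h1 => hne (mul_inv_eq_one.1 h1)) ?_
    have h2 := hmul (g * k⁻¹) k
    rw [inv_mul_cancel_right] at h2
    linarith
  rcases AddSubgroup.dense_or_cyclic φ.range with hdense | ⟨a, ha⟩
  · obtain ⟨c, hc, hcmem⟩ := hdense.exists_mem_open isOpen_Ioo (nonempty_Ioo.2 hη)
    obtain ⟨g, rfl⟩ := hc
    refine ⟨g.toMul, _, fun h1 => ?_, hcmem.1, hcmem.2, hχ g.toMul⟩
    have h2 : φ g = χ 1 := congrArg χ h1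
    have h3 := hmul 1 1
    rw [mul_one] at h3
    have := hcmem.1
    linarith
  -- If the image is generated by one real number, injectivity makes a preimage of it generate `G`.
  · exfalso
    have hmem : a ∈ φ.range := by rw [ha]; exact AddSubgroup.mem_closure_singleton_self a
    obtain ⟨g₀, hg₀⟩ := hmem
    refine hG ⟨g₀.toMul, fun g => ?_⟩
    have hg : φ (Additive.ofMul g) ∈ AddSubgroup.closure {a} := ha ▸ ⟨_, rfl⟩
    obtain ⟨n, hn⟩ := AddSubgroup.mem_closure_singleton.1 hg
    refine ⟨n, hinj _ _ ?_⟩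
    change φ (n • g₀) = φ (Additive.ofMul g)
    rw [map_zsmul, hg₀, hn]

theorem exists_isApproximation_of_translation (hρ : IsAnalyticAction ρ)
    (h : IsAbelCoordinate (ρ f) w τ δ κ)
    (hf : IsContractionOn (ρ f) δ C) (ha : 0 < a) (hab : a < b) (hbd : b < d) (hd : d < δ)
    (hB : ∀ g : G, g ≠ 1 →
      Tendsto (fun x => deriv (ρ g) x * w (ρ g x) / w x) (𝓝[>] 0) (𝓝 1))
    (hD : ∀ g : G, g ≠ 1 → ∃ c, c ≠ 0 ∧ Tendsto (fun x => τ (ρ g x) - τ x) (𝓝[>] 0) (𝓝 c))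
    (hG : ¬ IsCyclic G) :
    ∃ X k ε, IsApproximation ρ a b X k ε := by
  have hsub : Icc a b ⊆ Ioo 0 δ := fun x hx => ⟨ha.trans_le hx.1, by linarith [hx.2]⟩
  have hbd' : τ b < τ d :=
    h.strictMonoOn (hsub (right_mem_Icc.2 hab.le)) ⟨by linarith, hd⟩ hbd
  -- Diagonal choice: first an element whose limit translation is below `1 / (n + 1)`, then a
  -- conjugating power large enough for the relative errors to be below `1 / (n + 1)` on all of `[a,
  -- b]`.
  have hstep : ∀ n : ℕ, ∃ (k : G) (ε : ℝ), k ≠ 1 ∧ 0 < ε ∧ ε < 1 / ((n : ℝ) + 1) ∧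
      ∀ x ∈ Icc a b, ρ k x ∈ Ioo 0 d ∧ |(τ (ρ k x) - τ x) / ε - 1| < 1 / ((n : ℝ) + 1) ∧
        |deriv (ρ k) x * w (ρ k x) / w x - 1| < 1 / ((n : ℝ) + 1) := by
    intro n
    have hη : (0 : ℝ) < 1 / ((n : ℝ) + 1) := Nat.one_div_pos_of_nat
    obtain ⟨g, c, hg, hc0, hc, hgc⟩ := hρ.exists_small_translation hD hG
      (lt_min hη (sub_pos.2 hbd'))
    have hcd := hc.trans_le (min_le_right _ _)
    have hmem := hρ.eventually_conj h hf ha hab hbd hd g hgc hcd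
    have hder := hρ.tendsto_deriv_conj h hf ha hab hbd hd g hgc hcd (hB g hg)
    have hdis := (hgc.comp (hf.tendsto_iterate_uniform ha hab.le (hbd.trans hd))).div_const c
    rw [div_self hc0.ne'] at hdis
    have hall : ∀ᶠ i : ℕ × ℝ in atTop ×ˢ 𝓟 (Icc a b),
        ρ ((f ^ i.1)⁻¹ * g * f ^ i.1) i.2 ∈ Ioo 0 d ∧
        |(τ (ρ ((f ^ i.1)⁻¹ * g * f ^ i.1) i.2) - τ i.2) / c - 1| < 1 / ((n : ℝ) + 1) ∧
        |deriv (ρ ((f ^ i.1)⁻¹ * g * f ^ i.1)) i.2 *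
          w (ρ ((f ^ i.1)⁻¹ * g * f ^ i.1) i.2) / w i.2 - 1| < 1 / ((n : ℝ) + 1) := by
      filter_upwards [hmem, Metric.tendsto_nhds.1 hder _ hη, Metric.tendsto_nhds.1 hdis _ hη]
        with i h1 h2 h3
      refine ⟨h1.1, ?_, h2⟩
      rw [h1.2]
      exact h3
    obtain ⟨N, hN⟩ := (eventually_atTop_prod_principal (P := fun n' x =>
        ρ ((f ^ n')⁻¹ * g * f ^ n') x ∈ Ioo 0 d ∧
        |(τ (ρ ((f ^ n')⁻¹ * g * f ^ n') x) - τ x) / c - 1| < 1 / ((n : ℝ) + 1) ∧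
        |deriv (ρ ((f ^ n')⁻¹ * g * f ^ n')) x *
          w (ρ ((f ^ n')⁻¹ * g * f ^ n') x) / w x - 1| < 1 / ((n : ℝ) + 1)).1 hall).exists
    refine ⟨(f ^ N)⁻¹ * g * f ^ N, c, fun h1 => hg ?_, hc0, hc.trans_le (min_le_left _ _), hN⟩
    rwa [mul_assoc, inv_mul_eq_one, eq_comm, mul_eq_right] at h1
  choose k ε hk hε hεlt hkε using hstep
  have hlim : Tendsto (fun i : ℕ × ℝ => 1 / ((i.1 : ℝ) + 1)) (atTop ×ˢ 𝓟 (Icc a b)) (𝓝 0) :=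
    tendsto_one_div_add_atTop_nhds_zero_nat.comp tendsto_fst
  refine ⟨_, _, _, isApproximation_of_abel h ha hab hbd hd (k := k) (ε := ε) (θ := fun _ => 1) hε
    (squeeze_zero (fun n => (hε n).le) (fun n => (hεlt n).le)
      tendsto_one_div_add_atTop_nhds_zero_nat) continuousOn_const (fun _ _ => one_pos) hk ?_ ?_ ?_⟩
  · filter_upwards [eventually_snd_mem (Icc a b)] with i hi using (hkε i.1 i.2 hi).1
  · rw [tendsto_iff_norm_sub_tendsto_zero]
    refine squeeze_zero' (Eventually.of_forall fun _ => norm_nonneg _) ?_ hlim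
    filter_upwards [eventually_snd_mem (Icc a b)] with i hi
    rw [mul_one]
    exact (hkε i.1 i.2 hi).2.1.le
  · rw [tendsto_iff_norm_sub_tendsto_zero]
    refine squeeze_zero' (Eventually.of_forall fun _ => norm_nonneg _) ?_ hlim
    filter_upwards [eventually_snd_mem (Icc a b)] with i hi
    exact (hkε i.1 i.2 hi).2.2.le

end Approximation

/-- Substitute `g⁻¹ x` for `x`. This lets the constant `c` be taken positive. -/
theorem tendsto_displacement_inv (hρ : IsAnalyticAction ρ) {τ : ℝ → ℝ} {g : G} {m : ℕ} {c : ℝ}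
    (hD : Tendsto (fun x => (τ (ρ g x) - τ x) / x ^ m) (𝓝[>] 0) (𝓝 c)) :
    Tendsto (fun x => (τ (ρ g⁻¹ x) - τ x) / x ^ m) (𝓝[>] 0)
      (𝓝 (-(c * deriv (ρ g⁻¹) 0 ^ m))) := by
  refine ((hD.comp (hρ.tendsto_nhdsGT g⁻¹)).mul ((hρ.tendsto_div_self g⁻¹).pow m)).neg.congr' ?_
  filter_upwards [self_mem_nhdsWithin] with x hx
  have hx : 0 < x := hx
  have hgx := hρ.pos g⁻¹ hx
  have hinv := apply_inv ρ g x
  simp only [Function.comp_apply, hinv, div_pow]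
  field_simp
  ring

theorem exists_isApproximation (hρ : IsAnalyticAction ρ) (hG : ¬ IsCyclic G) :
    ∃ a b X k ε, 0 < a ∧ a < b ∧ b ≤ 1 ∧ IsApproximation ρ a b X k ε := by
  have hnt : Nontrivial G := by
    by_contra hns
    rw [not_nontrivial_iff_subsingleton] at hns
    exact hG isCyclic_of_subsingleton
  obtain ⟨f, q, bf, hq, hbf, hlead, hmin⟩ := hρ.exists_minimal_contraction
  have hlt : ∀ᶠ x in 𝓝[>] 0, ρ f x < x := by
    filter_upwards [hlead.eventually_lt_const hbf, self_mem_nhdsWithin] with x hx hx0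
    have hx0 : 0 < x ^ q := pow_pos hx0 q
    by_contra! hle
    exact hx.not_ge (div_nonneg (sub_nonneg.2 hle) hx0.le)
  obtain ⟨δ, C, hδ, hC, hf⟩ := exists_isContractionOn (hρ.contDiff f) (hρ.map_zero f)
    (hρ.deriv_pos f) hlt
  obtain ⟨τ, κ, h⟩ := hf.exists_abelCoordinate hδ hC
  have hwlim := hf.tendsto_abelDensity_mul_sub hδ hC
  set w := abelDensity (ρ f)
  have hA : 0 < 1 / (-bf) := by have := neg_pos.2 hbf; positivity
  -- Divide `w x * (x - f x) → 1` by `(x - f x) / x ^ q → -bf`.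
  have hw : Tendsto (fun x => w x * x ^ q) (𝓝[>] 0) (𝓝 (1 / (-bf))) := by
    refine (hwlim.div hlead.neg (neg_pos.2 hbf).ne').congr' ?_
    filter_upwards [Ioo_mem_nhdsGT hδ] with x hx
    have h1 := sub_pos.2 (hf.lt_self x hx)
    have h2 : 0 < x := hx.1
    rw [Pi.div_apply, ← neg_div, neg_sub]
    field_simp
  obtain ⟨β, hβ⟩ := IsAbelCoordinate.exists_tendsto_inv_mul_density hA hw hq
  have hmult : ∀ g : G, g ≠ 1 → ∃ r b, q ≤ r ∧ b ≠ 0 ∧ HasLeadingTerm (ρ g) r b ∧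
      (r = 1 → 1 + b = deriv (ρ g) 0) ∧ deriv (ρ g) 0 ^ q = deriv (ρ g) 0 := by
    intro g hg
    obtain ⟨r, b, hr, hb, hgr⟩ := hmin g hg
    refine ⟨r, b, hr, hb, hgr, ?_, ?_⟩
    · rintro rfl
      exact tendsto_nhds_unique hgr.tendsto_div_one (hρ.tendsto_div_self g)
    -- Either the element has order `1`, and then `q = 1` by minimality, or its order is at least
    -- `2` and its derivative at `0` is `1`.
    · rcases (hq.trans hr).eq_or_lt with h1 | h1
      · rw [show q = 1 by omega, pow_one]
      · rw [tendsto_nhds_unique (hρ.tendsto_div_self g) (hgr.tendsto_div h1), one_pow]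
  have hB : ∀ g : G, g ≠ 1 →
      Tendsto (fun x => deriv (ρ g) x * w (ρ g x) / w x) (𝓝[>] 0) (𝓝 1) := by
    intro g hg
    obtain ⟨r, b, -, -, -, -, hμ⟩ := hmult g hg
    exact IsAbelCoordinate.tendsto_deriv_mul_density hA hw (hρ.tendsto_nhdsGT g)
      (hρ.deriv_pos g 0) hμ (hρ.tendsto_div_self g) (hρ.tendsto_deriv g)
  have hD : ∀ g : G, g ≠ 1 → ∃ (m : ℕ) (c : ℝ), c ≠ 0 ∧
      Tendsto (fun x => (τ (ρ g x) - τ x) / x ^ m) (𝓝[>] 0) (𝓝 c) := by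
    intro g hg
    obtain ⟨r, b, hr, hb, hgr, hb1, -⟩ := hmult g hg
    obtain ⟨c, hc, hlim⟩ := h.exists_tendsto_displacement hδ hA hw hq hr (hρ.tendsto_nhdsGT g)
      hgr hb (fun h1 => hb1 h1 ▸ hρ.deriv_pos g 0)
    exact ⟨r - q, c, left_ne_zero_of_mul hc.ne', hlim⟩
  have hd0 : 0 < min δ 1 := lt_min hδ one_pos
  have hd1 : min δ 1 ≤ δ := min_le_left _ _
  have hd2 : min δ 1 ≤ 1 := min_le_right _ _
  -- Any `0 < a < b < d < δ` with `b ≤ 1` would do; `d` is `min δ 1 / 2`. The bound by `1` makes the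
  -- interval embed in the circle.
  refine ⟨min δ 1 / 4, min δ 1 / 3, ?_⟩
  suffices hs : ∃ X k ε, IsApproximation ρ (min δ 1 / 4) (min δ 1 / 3) X k ε by
    obtain ⟨X, k, ε, hs⟩ := hs
    exact ⟨X, k, ε, by linarith, by linarith, by linarith, hs⟩
  have ha : 0 < min δ 1 / 4 := by linarith
  have hab : min δ 1 / 4 < min δ 1 / 3 := by linarith
  have hbd : min δ 1 / 3 < min δ 1 / 2 := by linarith
  have hdδ : min δ 1 / 2 < δ := by linarith
  by_cases hcase : ∃ (g : G) (m : ℕ) (c : ℝ), g ≠ 1 ∧ m ≠ 0 ∧ c ≠ 0 ∧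
      Tendsto (fun x => (τ (ρ g x) - τ x) / x ^ m) (𝓝[>] 0) (𝓝 c)
  · obtain ⟨g, m, c, hg, hm, hc, hgc⟩ := hcase
    rcases hc.lt_or_gt with hc | hc
    · exact hρ.exists_isApproximation_of_higher_order h hf ha hab hbd hdδ hβ
        (inv_ne_one.2 hg) (hB _ (inv_ne_one.2 hg)) hm
        (neg_pos.2 (mul_neg_of_neg_of_pos hc (pow_pos (hρ.deriv_pos g⁻¹ 0) m)))
        (hρ.tendsto_displacement_inv hgc)
    · exact hρ.exists_isApproximation_of_higher_order h hf ha hab hbd hdδ hβ hg (hB g hg) hm hc hgc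
  · refine hρ.exists_isApproximation_of_translation h hf ha hab hbd hdδ hB (fun g hg => ?_) hG
    obtain ⟨m, c, hc, hgc⟩ := hD g hg
    obtain rfl : m = 0 := by
      by_contra hm
      exact hcase ⟨g, m, c, hg, hm, hc, hgc⟩
    exact ⟨c, hc, by simpa using hgc⟩

end IsAnalyticAction

end CircleDiff

/-! ### Euler approximation of the flow -/

namespace CircleDiff

/-- A primitive `σ` of `1 / X` is a time coordinate: along an integral curve `σ - t` has zero
derivative. No Lipschitz condition on `X` is needed. -/
theorem IsLocalFlowOn.apply_eq_add {X : ℝ → ℝ} {J K : Set ℝ} {t₀ : ℝ} {φ : ℝ → ℝ → ℝ}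
    (hφ : IsLocalFlowOn X J K t₀ φ) (ht : 0 < t₀) {σ : ℝ → ℝ} (hX : ∀ x ∈ J, X x ≠ 0)
    (hσ : ∀ x ∈ J, HasDerivAt σ (X x)⁻¹ x) {x : ℝ} (hx : x ∈ K) :
    σ (φ t₀ x) = σ x + t₀ := by
  obtain ⟨h0, hJ, hint⟩ := hφ x hx
  have hder : ∀ t ∈ Icc 0 t₀, HasDerivWithinAt (fun t => σ (φ t x) - t) 0 (Icc 0 t₀) t := by
    intro t htm
    have h1 := ((hσ _ (hJ t htm)).comp_hasDerivWithinAt t (hint t htm)).sub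
      (hasDerivWithinAt_id t (Icc 0 t₀))
    rwa [inv_mul_cancel₀ (hX _ (hJ t htm)), sub_self] at h1
  have := constant_of_derivWithin_zero (fun t htm => (hder t htm).differentiableWithinAt)
    (fun t htm => (hder t (Ico_subset_Icc_self htm)).derivWithin
      (uniqueDiffOn_Icc ht t (Ico_subset_Icc_self htm))) t₀ (right_mem_Icc.2 ht.le)
  simp only [h0] at this
  linarith

/-- Extending `X` by constants beyond the endpoints gives a time coordinate on the whole line, so
points that leave `[a, b]` need no separate treatment. -/
theorem exists_hasDerivAt_inv {X : ℝ → ℝ} {a b : ℝ} (hab : a ≤ b)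
    (hX : ContinuousOn X (Icc a b)) (hpos : ∀ x ∈ Icc a b, 0 < X x) :
    ∃ Y σ : ℝ → ℝ, Continuous Y ∧ (∀ x, 0 < Y x) ∧ EqOn Y X (Icc a b) ∧
      ∀ x, HasDerivAt σ (Y x)⁻¹ x := by
  have hYc : Continuous (IccExtend hab ((Icc a b).domRestrict X)) :=
    (continuousOn_iff_continuous_domRestrict.1 hX).Icc_extend'
  have hY0 : ∀ x, 0 < IccExtend hab ((Icc a b).domRestrict X) x := fun x =>
    hpos _ (projIcc a b hab x).2
  have hYi : Continuous fun x => (IccExtend hab ((Icc a b).domRestrict X) x)⁻¹ :=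
    hYc.inv₀ fun x => (hY0 x).ne'
  exact ⟨_, fun x => ∫ t in a..x, (IccExtend hab ((Icc a b).domRestrict X) t)⁻¹, hYc, hY0,
    fun x hx => IccExtend_of_mem hab _ hx, fun x => hYi.integral_hasStrictDerivAt a x |>.hasDerivAt⟩

section Euler

variable {X Y σ : ℝ → ℝ} {a b : ℝ}

/-- Asymptotics of displacements in the time coordinate `σ` of the vector field. -/
theorem tendsto_time_displacement (hYc : Continuous Y) (hY0 : ∀ x, 0 < Y x)
    (hYX : EqOn Y X (Icc a b)) (hσ : ∀ x, HasDerivAt σ (Y x)⁻¹ x) {g : ℕ → ℝ → ℝ} {ε : ℕ → ℝ}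
    (hε : ∀ n, 0 < ε n) (hε0 : Tendsto ε atTop (𝓝 0))
    (hg : Tendsto (fun i : ℕ × ℝ => (g i.1 i.2 - i.2) / (ε i.1 * X i.2))
      (atTop ×ˢ 𝓟 (Icc a b)) (𝓝 1)) :
    Tendsto (fun i : ℕ × ℝ => g i.1 i.2 - i.2) (atTop ×ˢ 𝓟 (Icc a b)) (𝓝 0) ∧
    Tendsto (fun i : ℕ × ℝ => (σ (g i.1 i.2) - σ i.2) / ε i.1) (atTop ×ˢ 𝓟 (Icc a b)) (𝓝 1) := by
  set l : Filter (ℕ × ℝ) := atTop ×ˢ 𝓟 (Icc a b)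
  have hIcc : ∀ᶠ i : ℕ × ℝ in l, i.2 ∈ Icc a b := eventually_snd_mem (Icc a b)
  obtain ⟨M, hM⟩ := isCompact_Icc.exists_bound_of_continuousOn (s := Icc a b) hYc.continuousOn
  have hdisp : Tendsto (fun i : ℕ × ℝ => g i.1 i.2 - i.2) l (𝓝 0) := by
    have h1 : Tendsto (fun i : ℕ × ℝ => ε i.1 * X i.2) l (𝓝 0) := by
      have h2 : Tendsto (fun i : ℕ × ℝ => ε i.1 * M) l (𝓝 0) := by
        simpa using (hε0.comp tendsto_fst).mul_const M
      refine squeeze_zero_norm' ?_ h2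
      filter_upwards [hIcc] with i hi
      rw [norm_mul, Real.norm_of_nonneg (hε i.1).le, ← hYX hi]
      exact mul_le_mul_of_nonneg_left (hM _ hi) (hε i.1).le
    have h3 := hg.mul h1
    rw [mul_zero] at h3
    refine h3.congr' ?_
    filter_upwards [hIcc] with i hi
    rw [← hYX hi]
    exact div_mul_cancel₀ _ (mul_pos (hε _) (hY0 _)).ne'
  refine ⟨hdisp, ?_⟩
  choose ξ hξ hξeq using fun i : ℕ × ℝ =>
    exists_mem_uIcc_sub_eq (y := i.2) (z := g i.1 i.2) fun x _ => hσ x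
  have hξ0 : Tendsto (fun i => ξ i - i.2) l (𝓝 0) := by
    refine tendsto_of_mem_uIcc (u := fun _ => 0) tendsto_const_nhds hdisp
      (Eventually.of_forall fun i => ?_)
    have := hξ i
    rw [mem_uIcc] at this ⊢
    rcases this with h | h
    · left; constructor <;> linarith
    · right; constructor <;> linarith
  have hiI : ∀ᶠ i : ℕ × ℝ in l, i.2 ∈ Icc (a - 1) (b + 1) :=
    hIcc.mono fun i hi => ⟨by linarith [hi.1], by linarith [hi.2]⟩
  have hξI : ∀ᶠ i : ℕ × ℝ in l, ξ i ∈ Icc (a - 1) (b + 1) := by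
    filter_upwards [hIcc, hξ0.eventually (Ioo_mem_nhds (neg_one_lt_zero (R := ℝ)) one_pos)]
      with i h1 h2
    exact ⟨by linarith [h1.1, h2.1], by linarith [h1.2, h2.2]⟩
  have hYξ := tendsto_div_of_continuousOn_Icc (F := Y) (a := a - 1) (b := b + 1)
    hYc.continuousOn (fun x _ => hY0 x) hξI hiI hξ0
  have hlim := hg.div hYξ one_ne_zero
  rw [div_one] at hlim
  refine hlim.congr' ?_
  filter_upwards [hIcc] with i hi
  have h1 := hY0 (ξ i)
  have h2 := hY0 i.2
  have h3 := hε i.1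
  rw [Pi.div_apply, hξeq, ← hYX hi]
  field_simp

/-- Error estimate for the iterates of a map which is close to the time-`ε` map of the flow. -/
theorem iterate_time_displacement (hσ : StrictMono σ) {g : ℝ → ℝ} {ε η t₀ c d x : ℝ}
    (hε : 0 < ε) (hη0 : 0 < η) (hη1 : η < 1) (hg : ∀ x ∈ Icc a b, |σ (g x) - σ x - ε| ≤ η * ε)
    (hac : a ≤ c) (hx : x ∈ Icc c d) (hdb : d ≤ b) (ht : σ d + t₀ + η * t₀ ≤ σ b) (j : ℕ)
    (hj : j * ε ≤ t₀) :
    g^[j] x ∈ Icc a b ∧ |σ (g^[j] x) - σ x - j * ε| ≤ η * (j * ε) := by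
  induction j with
  | zero =>
    simpa using ⟨hac.trans hx.1, hx.2.trans hdb⟩
  | succ j ih =>
    push_cast at hj ⊢
    obtain ⟨h1, h2⟩ := ih (by linarith)
    have h3 := hg _ h1
    rw [Function.iterate_succ_apply']
    have h4 : |σ (g (g^[j] x)) - σ x - (j + 1) * ε| ≤ η * ((j + 1) * ε) := by
      rw [abs_le] at h2 h3 ⊢
      constructor <;> linarith
    -- At the left end `η < 1` keeps the net displacement nonnegative; at the right end the room
    -- left by `ht` absorbs the error.
    refine ⟨⟨hσ.le_iff_le.1 ?_, hσ.le_iff_le.1 ?_⟩, h4⟩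
    · have h5 : σ a ≤ σ x := hσ.monotone (hac.trans hx.1)
      have h6 : η * ((j + 1) * ε) ≤ 1 * ((j + 1) * ε) :=
        mul_le_mul_of_nonneg_right hη1.le (by positivity)
      linarith [(abs_le.1 h4).1]
    · have h5 : σ x ≤ σ d := hσ.monotone hx.2
      have h6 : η * ((j + 1) * ε) ≤ η * t₀ := mul_le_mul_of_nonneg_left hj hη0.le
      linarith [(abs_le.1 h4).2]

theorem tendstoUniformlyOn_iterate_flow (hab : a ≤ b)
    (hX : ContinuousOn X (Icc a b)) (hpos : ∀ x ∈ Icc a b, 0 < X x) {g : ℕ → ℝ → ℝ} {ε : ℕ → ℝ}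
    (hε : ∀ n, 0 < ε n) (hε0 : Tendsto ε atTop (𝓝 0))
    (hg : Tendsto (fun i : ℕ × ℝ => (g i.1 i.2 - i.2) / (ε i.1 * X i.2))
      (atTop ×ˢ 𝓟 (Icc a b)) (𝓝 1)) {c d t₀ : ℝ} {φ : ℝ → ℝ → ℝ} (hcd : c ≤ d)
    (hsub : Icc c d ⊆ Ioo a b) (ht : 0 < t₀) (hφ : IsLocalFlowOn X (Ioo a b) (Icc c d) t₀ φ) :
    TendstoUniformlyOn (fun n => (g n)^[⌊t₀ / ε n⌋₊]) (φ t₀) atTop (Icc c d) := by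
  obtain ⟨Y, σ, hYc, hY0, hYX, hσ⟩ := exists_hasDerivAt_inv hab hX hpos
  have htime := (tendsto_time_displacement hYc hY0 hYX hσ hε hε0 hg).2
  have hmono : StrictMono σ := strictMono_of_deriv_pos fun x => by
    rw [(hσ x).deriv]; exact inv_pos.2 (hY0 x)
  have hflow : ∀ x ∈ Icc c d, σ (φ t₀ x) = σ x + t₀ := fun x hx =>
    hφ.apply_eq_add ht (fun y hy => (hpos y (Ioo_subset_Icc_self hy)).ne')
      (fun y hy => hYX (Ioo_subset_Icc_self hy) ▸ hσ y) hx
  have hφJ : ∀ x ∈ Icc c d, φ t₀ x ∈ Ioo a b := fun x hx =>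
    (hφ x hx).2.1 t₀ (right_mem_Icc.2 ht.le)
  obtain ⟨M, hM⟩ := isCompact_Icc.exists_bound_of_continuousOn (s := Icc a b) hYc.continuousOn
  have hM0 : 0 < M := (hY0 a).trans_le ((le_abs_self _).trans (hM a (left_mem_Icc.2 hab)))
  have hLip : ∀ u ∈ Icc a b, ∀ v ∈ Icc a b, |v - u| ≤ M * |σ v - σ u| := fun u hu v hv => by
    obtain ⟨ξ, hξ, heq⟩ := exists_mem_uIcc_sub_eq (y := u) (z := v) fun x _ => hσ x
    have h1 : v - u = Y ξ * (σ v - σ u) := by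
      rw [heq, mul_inv_cancel_left₀ (hY0 ξ).ne']
    rw [h1, abs_mul]
    exact mul_le_mul_of_nonneg_right (hM ξ (ordConnected_Icc.uIcc_subset hu hv hξ))
      (abs_nonneg _)
  -- The flow carries `d` to a point strictly below `b`, which leaves room for the accumulated
  -- error.
  have hdroom : 0 < σ b - (σ d + t₀) := by
    rw [← hflow d (right_mem_Icc.2 hcd), sub_pos]
    exact hmono (hφJ d (right_mem_Icc.2 hcd)).2
  rw [Metric.tendstoUniformlyOn_iff]
  intro e he
  -- The three bounds on `η` keep the steps forward, keep the orbit inside `[a, b]`, and make `M * η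
  -- * t₀ < e / 2`; the other half of `e` covers the rounding of `t₀ / ε n`.
  obtain ⟨η, hη0, hη⟩ := exists_between
    (show (0 : ℝ) < min (min 1 ((σ b - (σ d + t₀)) / t₀)) (e / (2 * M * t₀)) from
      lt_min (lt_min one_pos (div_pos hdroom ht)) (by positivity))
  rw [lt_min_iff, lt_min_iff, lt_div_iff₀ ht, lt_div_iff₀ (by positivity)] at hη
  obtain ⟨⟨hη1, hη2⟩, hη3⟩ := hη
  have hstep : ∀ᶠ n in atTop, ∀ x ∈ Icc a b, |(σ (g n x) - σ x) / ε n - 1| < η :=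
    eventually_atTop_prod_principal.1 (Metric.tendsto_nhds.1 htime η hη0)
  filter_upwards [hstep, hε0.eventually_lt_const (show 0 < e / (2 * M) by positivity)]
    with n hn hεn x hx
  have hεpos := hε n
  have hgn : ∀ y ∈ Icc a b, |σ (g n y) - σ y - ε n| ≤ η * ε n := fun y hy => by
    have h1 : σ (g n y) - σ y - ε n = ((σ (g n y) - σ y) / ε n - 1) * ε n := by field_simp
    rw [h1, abs_mul, abs_of_pos hεpos]
    exact mul_le_mul_of_nonneg_right (hn y hy).le hεpos.le
  have hN1 : (⌊t₀ / ε n⌋₊ : ℝ) * ε n ≤ t₀ := by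
    rw [← le_div_iff₀ hεpos]; exact Nat.floor_le (by positivity)
  have hN2 : t₀ < (⌊t₀ / ε n⌋₊ : ℝ) * ε n + ε n := by
    have := Nat.lt_floor_add_one (t₀ / ε n)
    rw [div_lt_iff₀ hεpos] at this
    linarith
  obtain ⟨h1, h2⟩ := iterate_time_displacement hmono hεpos hη0 hη1 hgn
    (hsub (left_mem_Icc.2 hcd)).1.le hx (hsub (right_mem_Icc.2 hcd)).2.le (by linarith) _ hN1
  rw [Real.dist_eq]
  have h3 : |σ (φ t₀ x) - σ ((g n)^[⌊t₀ / ε n⌋₊] x)| ≤ η * t₀ + ε n := by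
    have h4 : η * ((⌊t₀ / ε n⌋₊ : ℝ) * ε n) ≤ η * t₀ := mul_le_mul_of_nonneg_left hN1 hη0.le
    rw [hflow x hx]
    rw [abs_le] at h2 ⊢
    constructor <;> linarith
  have h5 := (hLip _ h1 _ (Ioo_subset_Icc_self (hφJ x hx))).trans
    (mul_le_mul_of_nonneg_left h3 hM0.le)
  have h6 : M * ε n < e / 2 := by
    rw [lt_div_iff₀ (by positivity)] at hεn
    linarith
  linarith

end Euler

end CircleDiff

/-! ### From the circle to the line and back -/

namespace CircleDiff

section Lift

variable {F F' : ℝ → ℝ} {f g : UnitAddCircle ≃ₜ UnitAddCircle}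

/-- Uniqueness of lifts through the covering `ℝ → ℝ/ℤ`. It makes the choice of lifts fixing a point
multiplicative. -/
theorem IsLift.eq_of_apply_eq (hF : IsLift F f) (hF' : IsLift F' f) {x₀ : ℝ}
    (h : F x₀ = F' x₀) : F = F' := by
  refine (AddCircle.isCoveringMap_coe (1 : ℝ)).eq_of_comp_eq hF.1 hF'.1 ?_ x₀ h
  funext x
  exact (hF.2 x).trans (hF'.2 x).symm

theorem IsLift.one : IsLift id 1 :=
  ⟨continuous_id, fun _ => rfl⟩

theorem IsLift.mul (hF : IsLift F f) (hF' : IsLift F' g) : IsLift (F ∘ F') (f * g) :=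
  ⟨hF.1.comp hF'.1, fun x => by rw [Function.comp_apply, hF.2, hF'.2]; rfl⟩

theorem IsLift.iterate (hF : IsLift F f) (n : ℕ) : IsLift (F^[n]) (f ^ n) := by
  induction n with
  | zero => rw [Function.iterate_zero, pow_zero]; exact IsLift.one
  | succ n ih => rw [Function.iterate_succ, pow_succ]; exact ih.mul hF

theorem HasAnalyticLift.exists_lift_fixing (hf : HasAnalyticLift f) {x₀ : ℝ}
    (hx₀ : f (x₀ : UnitAddCircle) = x₀) :
    ∃ F, IsLift F f ∧ AnalyticOnNhd ℝ F univ ∧ (∀ x, 0 < deriv F x) ∧ F x₀ = x₀ := by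
  obtain ⟨F, hF, hFa, hFd⟩ := hf
  have h1 : ((F x₀ - x₀ : ℝ) : UnitAddCircle) = 0 := by
    rw [AddCircle.coe_sub, hF.2, hx₀, sub_self]
  -- The constant subtracted is an integer, since `F x₀` and `x₀` have the same image in the circle.
  refine ⟨fun x => F x - (F x₀ - x₀), ⟨hF.1.sub continuous_const, fun x => ?_⟩,
    hFa.sub analyticOnNhd_const, fun x => ?_, by ring⟩
  · rw [AddCircle.coe_sub, h1, sub_zero, hF.2]
  · rw [deriv_sub_const]
    exact hFd x

end Lift

/-- The stabilizer of a point acts on the line, by lifts that fix a given point over it. -/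
theorem exists_isAnalyticAction {Γ : Subgroup (UnitAddCircle ≃ₜ UnitAddCircle)}
    (hΓ : Γ ≤ DiffOmegaPlus) (p₀ : ℝ) :
    ∃ ρ : stab Γ (p₀ : UnitAddCircle) →* Equiv.Perm ℝ, IsAnalyticAction ρ ∧
      ∀ g, IsLift (fun x => ρ g (x - p₀) + p₀) g.1.1 := by
  have hex : ∀ g : stab Γ (p₀ : UnitAddCircle), ∃ F, IsLift F g.1.1 ∧
      AnalyticOnNhd ℝ F univ ∧ (∀ x, 0 < deriv F x) ∧ F p₀ = p₀ := fun g =>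
    (hΓ g.1.2).1.exists_lift_fixing g.2
  choose L hL hLa hLd hLp using hex
  -- A monoid homomorphism from a group to self-maps lands in permutations, so no inverse lift has
  -- to be built. Translation by `p₀` moves the fixed point to `0`.
  let φ : stab Γ (p₀ : UnitAddCircle) →* Function.End ℝ :=
    { toFun := fun g x => L g (x + p₀) - p₀
      map_one' := by
        have h1 : L 1 = id := (hL 1).eq_of_apply_eq IsLift.one (hLp 1)
        funext x
        simp [h1]
        rfl
      map_mul' := fun g k => by
        have h1 : L (g * k) = L g ∘ L k :=
          (hL (g * k)).eq_of_apply_eq ((hL g).mul (hL k)) (x₀ := p₀) (by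
            rw [Function.comp_apply, hLp, hLp, hLp])
        funext x
        change L (g * k) (x + p₀) - p₀ = L g (L k (x + p₀) - p₀ + p₀) - p₀
        rw [h1, Function.comp_apply, sub_add_cancel] }
  have hφ : ∀ g x, φ.toHomPerm g x = L g (x + p₀) - p₀ := fun g x => rfl
  have hφ' : ∀ g, ⇑(φ.toHomPerm g) = fun x => L g (x + p₀) - p₀ := fun g => rfl
  have hlift : ∀ g, (fun x => φ.toHomPerm g (x - p₀) + p₀) = L g := fun g => by
    funext x
    rw [hφ, sub_add_cancel, sub_add_cancel]
  refine ⟨φ.toHomPerm, ⟨fun g x _ => ?_, fun g x => ?_, fun g => ?_, fun g k hgk => ?_⟩,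
    fun g => ?_⟩
  · rw [hφ']
    have h1 : AnalyticAt ℝ (fun y : ℝ => y + p₀) x := analyticAt_id.add analyticAt_const
    exact (AnalyticAt.fun_comp (g := L g) (f := fun y => y + p₀) (x := x)
      (hLa g (x + p₀) (mem_univ _)) h1).sub analyticAt_const
  · rw [hφ', deriv_sub_const, deriv_comp_add_const]
    exact hLd g _
  · rw [hφ, zero_add, hLp, sub_self]
  · have h1 : L g = L k := by rw [← hlift g, ← hlift k, hgk]
    refine Subtype.ext (Subtype.ext (Homeomorph.ext fun y => ?_))
    obtain ⟨x, rfl⟩ := QuotientAddGroup.mk_surjective y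
    exact ((hL g).2 x).symm.trans ((congrArg (fun F : ℝ → ℝ => (F x : UnitAddCircle)) h1).trans
      ((hL k).2 x))
  · rw [hlift]
    exact hL g

theorem tendsto_shift (a b c : ℝ) :
    Tendsto (fun i : ℕ × ℝ => (i.1, i.2 - c)) (atTop ×ˢ 𝓟 (Icc (a + c) (b + c)))
      (atTop ×ˢ 𝓟 (Icc a b)) :=
  tendsto_id.prodMap (g := fun x => x - c) (tendsto_principal_principal.2 fun x hx =>
    mem_Icc.2 ⟨by linarith [hx.1], by linarith [hx.2]⟩)

theorem tendstoUniformlyOn_of_tendsto {F : ℕ → ℝ → ℝ} {G : ℝ → ℝ} {S T : Set ℝ}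
    (h : Tendsto (fun i : ℕ × ℝ => F i.1 i.2 - G i.2) (atTop ×ˢ 𝓟 S) (𝓝 0)) (hTS : T ⊆ S) :
    TendstoUniformlyOn F G atTop T := by
  rw [Metric.tendstoUniformlyOn_iff]
  intro e he
  have h1 : ∀ᶠ n in atTop, ∀ x ∈ S, |F n x - G x - 0| < e :=
    eventually_atTop_prod_principal.1 (Metric.tendsto_nhds.1 h e he)
  filter_upwards [h1] with n hn x hx
  have := hn x (hTS hx)
  rwa [sub_zero, abs_sub_comm] at this

theorem locallyNondiscrete_and_exists_vectorField
    (Γ : Subgroup (UnitAddCircle ≃ₜ UnitAddCircle)) (hΓ : Γ ≤ DiffOmegaPlus)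
    (p : UnitAddCircle) (hp : ¬ IsCyclic (stab Γ p)) :
    LocallyNondiscrete 1 Γ ∧
      ∃ (a b : ℝ) (X : ℝ → ℝ), a < b ∧ b ≤ a + 1 ∧
        ContinuousOn X (Ioo a b) ∧ (∀ x ∈ Ioo a b, X x ≠ 0) ∧
        InCrClosure 0 Γ a b X := by
  obtain ⟨p₀, rfl⟩ := QuotientAddGroup.mk_surjective p
  obtain ⟨ρ, hρ, hlift⟩ := exists_isAnalyticAction hΓ p₀
  obtain ⟨a, b, X, k, ε, ha, hab, hb, happ⟩ := hρ.exists_isApproximation hp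
  have hXc : ContinuousOn (fun x => X (x - p₀)) (Icc (a + p₀) (b + p₀)) :=
    happ.continuousOn.comp (by fun_prop) fun x hx => ⟨by linarith [hx.1], by linarith [hx.2]⟩
  have hX0 : ∀ x ∈ Icc (a + p₀) (b + p₀), 0 < X (x - p₀) := fun x hx =>
    happ.pos _ ⟨by linarith [hx.1], by linarith [hx.2]⟩
  have hdisp : Tendsto (fun i : ℕ × ℝ => (ρ (k i.1) (i.2 - p₀) + p₀ - i.2) /
      (ε i.1 * X (i.2 - p₀))) (atTop ×ˢ 𝓟 (Icc (a + p₀) (b + p₀))) (𝓝 1) := by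
    refine (happ.displacement.comp (tendsto_shift a b p₀)).congr fun i => ?_
    simp only [Function.comp_apply, sub_sub_eq_add_sub]
  have hab' : a + p₀ < b + p₀ := by linarith
  constructor
  · refine ⟨a + p₀, b + p₀, hab', by linarith, fun n => (k n).1.1, fun n => ⟨(k n).1.2, ?_⟩,
      fun n x => ρ (k n) (x - p₀) + p₀, fun n => hlift (k n), fun j hj => ?_⟩
    · exact fun h1 => happ.ne_one n (Subtype.ext (Subtype.ext h1))
    · obtain ⟨Y, σ, hYc, hY0, hYX, hσ⟩ := exists_hasDerivAt_inv hab'.le hXc hX0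
      have hj' : j ≤ 1 := by exact_mod_cast hj
      obtain rfl | rfl : j = 0 ∨ j = 1 := by omega
      · simp only [iteratedDeriv_zero, iteratedDerivWithin_zero]
        exact tendstoUniformlyOn_of_tendsto (tendsto_time_displacement hYc hY0 hYX hσ
          happ.eps_pos happ.eps_tendsto (g := fun n x => ρ (k n) (x - p₀) + p₀) hdisp).1
          Ioo_subset_Icc_self
      · have h1 : Tendsto (fun i : ℕ × ℝ => deriv (fun x => ρ (k i.1) (x - p₀) + p₀) i.2 - 1)
            (atTop ×ˢ 𝓟 (Icc (a + p₀) (b + p₀))) (𝓝 0) := by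
          have h2 := (happ.deriv.comp (tendsto_shift a b p₀)).sub_const 1
          rw [sub_self] at h2
          refine h2.congr fun i => ?_
          rw [Function.comp_apply, deriv_add_const, deriv_comp_sub_const]
        refine (tendstoUniformlyOn_of_tendsto (G := fun _ => 1)
          (F := fun n => deriv (fun x => ρ (k n) (x - p₀) + p₀)) h1
          Ioo_subset_Icc_self).congr_right (fun x hx => ?_) |>.congr
          (Eventually.of_forall fun n x _ => ?_)
        · simp only [iteratedDerivWithin_one]
          rw [derivWithin_id _ _ (isOpen_Ioo.uniqueDiffWithinAt hx)]
        · simp only [iteratedDeriv_one]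
  · refine ⟨a + p₀, b + p₀, fun x => X (x - p₀), hab', by linarith,
      hXc.mono Ioo_subset_Icc_self, fun x hx => (hX0 x (Ioo_subset_Icc_self hx)).ne', ?_⟩
    intro c d hcd hsub t₀ ht φ hφ
    -- Each application of `k n` advances the flow time by about `ε n`, hence the exponent.
    refine ⟨fun n => (k n).1.1 ^ ⌊t₀ / ε n⌋₊, fun n => Γ.pow_mem (k n).1.2 _,
      fun n => (fun x => ρ (k n) (x - p₀) + p₀)^[⌊t₀ / ε n⌋₊],
      fun n => (hlift (k n)).iterate _, fun j hj => ?_⟩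
    obtain rfl : j = 0 := by simpa using hj
    simp only [iteratedDeriv_zero, iteratedDerivWithin_zero]
    exact tendstoUniformlyOn_iterate_flow hab'.le hXc hX0 happ.eps_pos happ.eps_tendsto
      (g := fun n x => ρ (k n) (x - p₀) + p₀) hdisp hcd.le hsub ht hφ

end CircleDiff

theorem proposition3p7
    (Γ : Subgroup (UnitAddCircle ≃ₜ UnitAddCircle)) (hΓ : Γ ≤ CircleDiff.DiffOmegaPlus)
    (p : UnitAddCircle) (hp : ¬ IsCyclic (CircleDiff.stab Γ p)) :
    CircleDiff.LocallyNondiscrete 1 Γ ∧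
      ∃ (a b : ℝ) (X : ℝ → ℝ), a < b ∧ b ≤ a + 1 ∧
        ContinuousOn X (Ioo a b) ∧ (∀ x ∈ Ioo a b, X x ≠ 0) ∧
        CircleDiff.InCrClosure 0 Γ a b X :=
  CircleDiff.locallyNondiscrete_and_exists_vectorField Γ hΓ p hp
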